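/- Let $1\le k<n$ be integers. Put $\Lambda_n=\Lambda(x_1,\dots,x_n)$ (exterior algebra over $\mathbb F_2$), $Y_n=\mathbb F_2[y_1,\dots,y_n]$ and $N_n=\Lambda_n\otimes Y_n$, graded by topological degree with $|x_i|=1$, $|y_i|=2$, so that $N_n^{m,*}=\bigoplus_{a+2b=m}\Lambda_n^a\otimes Y_n^{2b}$. (This is the mod 2 motivic cohomology of $B(\mathbb Z/2)^n$ over $\mathbb C$, modulo $\tau$.) The Bockstein $Q_0$ is the derivation of $N_n$ with $Q_0(x_i)=y_i$, $Q_0(y_i)=0$. The reduced powers $\mathcal P^a$ act on $Y_n$ through the Cartan formula and $\mathcal P^1y_i=y_i^2$, $\mathcal P^ay_i=0$ for $a\ge2$; $P^+(Y_n)$ denotes the span of the images of all $\mathcal P^a$, $a\ge1$. For a monomial $z=x_1^{\varepsilon_1}\cdots x_n^{\varepsilon_n}y_1^{e_1}\cdots y_n^{e_n}$ with $\varepsilon_i\in\{0,1\}$ write $\varepsilon_i+2e_i=\sum_{j\ge0}\alpha_{ij}(z)2^j$ in binary, and set $\alpha_i(z)=\sum_j\alpha_{ij}(z)$, $\omega_j(z)=\sum_i\alpha_{ij}(z)$.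 Let $G_n\subset Y_n$ be the subspace spanned by $P^+(Y_n)$ and by all monomials $y\in Y_n$ with $(\omega_1(y),\dots,\omega_k(y))<(n-1,\dots,n-1)$ lexicographically. Let $d_1=(n-1)(2^k-1)$ and $d=k+2d_1$. Let $\mathrm{pr}_k:N_n^{d,*}\to\Lambda_n^k\otimes Y_n^{2d_1}$ be the projection onto this summand and $\pi:\Lambda_n^k\otimes Y_n^{2d_1}\to\Lambda_n^k\otimes(Y_n/G_n)^{2d_1}$ the quotient map. Let $\mathrm{mono}(k)$ be the set of strictly increasing maps $\sigma:\{1,\dots,k\}\to\{1,\dots,n\}$, and for $\sigma\in\mathrm{mono}(k)$ let $$\sigma(z_k)=x_{\sigma(1)}\cdots x_{\sigma(k)}\prod_{j=1}^k y_{\sigma(j)}^{2^k-2^{k-j}-1}\prod_{i\notin\operatorname{im}\sigma}y_i^{2^k-1}.$$ Let $V$ be the span of the $\pi(\sigma(z_k))$, $\sigma\in\mathrm{mono}(k)$. Call a set $M_0$ of monomials of $\Lambda_n^k\otimes Y_n^{2d_1}$, each having $\alpha_i<k$ for some $i$, a complementary block if the elements $\pi(m)$, $m\in M_0$, together with the elements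 $\pi(\sigma(z_k))$, $\sigma\in\mathrm{mono}(k)$, form a basis of $\Lambda_n^k\otimes(Y_n/G_n)^{2d_1}$. For such $M_0$ put $U_0=\langle\pi(m)\mid m\in M_0\rangle$, so that $\Lambda_n^k\otimes(Y_n/G_n)^{2d_1}=U_0\oplus V$; let $p_{M_1}$ be the projection onto $V$ with kernel $U_0$, let $\vartheta=p_{M_1}\circ\pi\circ\mathrm{pr}_k:N_n^{d,*}\to V$, and let $\varepsilon:V\to\mathbb F_2$ be the sum of the coordinates in the basis $(\pi(\sigma(z_k)))_\sigma$. Then a complementary block $M_0$ exists, $\dim V=\binom nk$, and for every complementary block $M_0$ $$\vartheta\bigl(Q_0(N_n^{d-1,*})\bigr)=\ker(\varepsilon)\subset V;$$ equivalently, under the identification $V\cong\mathbb F_2^{\mathrm{mono}(k)}$ that sends $\pi(\sigma(z_k))$ to the standard basis vector $e_\sigma$, the subspace $\vartheta(Q_0(N_n^{d-1,*}))$ is exactly the even-parity hyperplane $\{w\mid\sum_\sigma w_\sigma=0\}$. -/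

import Mathlib

open scoped TensorProduct

noncomputable section

namespace MotivicHit

/-! ### The algebra `N = Λ(x₁,…,xₙ) ⊗ 𝔽₂[y₁,…,yₙ]` -/

/-- The exterior algebra `Λ(x₁,…,xₙ)` over `𝔽₂`; `xᵢ` is the `i`-th standard basis vector. -/
abbrev Lam (n : ℕ) : Type := ExteriorAlgebra (ZMod 2) (Fin n → ZMod 2)

/-- The polynomial algebra `𝔽₂[y₁,…,yₙ]`. -/
abbrev Y (n : ℕ) : Type := MvPolynomial (Fin n) (ZMod 2)

/-- `N = Λ(x₁,…,xₙ) ⊗ 𝔽₂[y₁,…,yₙ]`. -/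
abbrev N (n : ℕ) : Type := Lam n ⊗[ZMod 2] Y n

/-- The generator `xᵢ` of the exterior algebra. -/
def x {n : ℕ} (i : Fin n) : Lam n := ExteriorAlgebra.ι (ZMod 2) (Pi.single i 1)

/-- The exterior component `Λᵃ`. -/
abbrev LamDeg (n a : ℕ) : Submodule (ZMod 2) (Lam n) := ⋀[ZMod 2]^a (Fin n → ZMod 2)

/-- The component `Y^{2b}`. Since `yᵢ` has topological degree `2`, it consists of the
homogeneous polynomials of polynomial degree `b`. -/
abbrev YDeg (n b : ℕ) : Submodule (ZMod 2) (Y n) :=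
  MvPolynomial.homogeneousSubmodule (Fin n) (ZMod 2) b

/-- The summand `Λᵃ ⊗ Y^{2b}` of `N`. -/
def NSummand (n a b : ℕ) : Submodule (ZMod 2) (N n) :=
  LinearMap.range (TensorProduct.map (LamDeg n a).subtype (YDeg n b).subtype)

/-- The component `N^{d,*} = ⨁_{a+2b=d} Λᵃ ⊗ Y^{2b}` of topological degree `d`. -/
def NDeg (n d : ℕ) : Submodule (ZMod 2) (N n) :=
  ⨆ (a : ℕ) (b : ℕ) (_ : a + 2 * b = d), NSummand n a b

/-! ### The Bockstein -/

/-- The contraction `∂_f` of the exterior algebra along a linear form `f`. -/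
def contr {n : ℕ} (f : Module.Dual (ZMod 2) (Fin n → ZMod 2)) : Lam n →ₗ[ZMod 2] Lam n :=
  CliffordAlgebra.contractLeft (Q := (0 : QuadraticForm (ZMod 2) (Fin n → ZMod 2))) f

theorem contr_ι_mul {n : ℕ} (f : Module.Dual (ZMod 2) (Fin n → ZMod 2)) (m : Fin n → ZMod 2)
    (b : Lam n) : contr f (ExteriorAlgebra.ι (ZMod 2) m * b) =
      f m • b + ExteriorAlgebra.ι (ZMod 2) m * contr f b := by
  have h := CliffordAlgebra.contractLeft_ι_mul
    (Q := (0 : QuadraticForm (ZMod 2) (Fin n → ZMod 2))) f m b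
  have h2 : ∀ u : Lam n, -u = u := fun u => by
    have : ((-1 : ZMod 2)) • u = (1 : ZMod 2) • u := by rw [show (-1 : ZMod 2) = 1 from by decide]
    rwa [neg_one_smul, one_smul] at this
  rw [sub_eq_add_neg] at h
  exact h.trans (congrArg (fun t : Lam n => f m • b + t) (h2 _))

theorem contr_mul {n : ℕ} (f : Module.Dual (ZMod 2) (Fin n → ZMod 2)) (a b : Lam n) :
    contr f (a * b) = contr f a * b + a * contr f b := by
  induction a using CliffordAlgebra.left_induction with
  | algebraMap r =>
    have h1 : contr f (algebraMap (ZMod 2) (Lam n) r) = 0 :=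
      CliffordAlgebra.contractLeft_algebraMap _ f r
    have h2 : contr f (algebraMap (ZMod 2) (Lam n) r * b)
        = algebraMap (ZMod 2) (Lam n) r * contr f b :=
      CliffordAlgebra.contractLeft_algebraMap_mul f r b
    change contr f (algebraMap (ZMod 2) (Lam n) r * b) =
      contr f (algebraMap (ZMod 2) (Lam n) r) * b + algebraMap (ZMod 2) (Lam n) r * contr f b
    rw [h1, h2, zero_mul, zero_add]
  | add u v hu hv =>
    rw [add_mul, map_add, hu, hv, map_add, add_mul, add_mul]; abel
  | ι_mul u m hu =>
    change contr f (ExteriorAlgebra.ι (ZMod 2) m * u * b) =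
      contr f (ExteriorAlgebra.ι (ZMod 2) m * u) * b + ExteriorAlgebra.ι (ZMod 2) m * u * contr f b
    rw [mul_assoc, contr_ι_mul, hu, contr_ι_mul, add_mul, mul_add, smul_mul_assoc,
      mul_assoc, mul_assoc, add_assoc]

theorem contr_mem {n : ℕ} (f : Module.Dual (ZMod 2) (Fin n → ZMod 2)) (a : ℕ) {u : Lam n}
    (hu : u ∈ LamDeg n (a + 1)) : contr f u ∈ LamDeg n a := by
  induction a generalizing u with
  | zero =>
    rw [LamDeg, ExteriorAlgebra.exteriorPower, zero_add, pow_one] at hu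
    obtain ⟨m, rfl⟩ := hu
    have := contr_ι_mul f m 1
    rw [mul_one, show contr f (1 : Lam n) = 0 from CliffordAlgebra.contractLeft_one _ f,
      mul_zero, add_zero] at this
    rw [this]
    refine Submodule.smul_mem _ _ ?_
    rw [LamDeg, ExteriorAlgebra.exteriorPower, pow_zero]
    exact Submodule.one_le.1 le_rfl
  | succ a ih =>
    rw [LamDeg, ExteriorAlgebra.exteriorPower, pow_succ'] at hu
    refine Submodule.mul_induction_on hu ?_ ?_
    · rintro _ ⟨m, rfl⟩ v hv
      rw [contr_ι_mul]
      refine add_mem (Submodule.smul_mem _ _ hv) ?_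
      rw [LamDeg, ExteriorAlgebra.exteriorPower, pow_succ']
      exact Submodule.mul_mem_mul ⟨m, rfl⟩ (ih hv)
    · intro v w hv hw
      rw [map_add]
      exact add_mem hv hw

/-- The Bockstein `Q₀ = ∑ᵢ ∂/∂xᵢ ⊗ yᵢ`. By `Q0_x`, `Q0_y`, `Q0_mul` below it is the derivation
of `N` with `xᵢ ↦ yᵢ` and `yᵢ ↦ 0`. -/
def Q0 (n : ℕ) : N n →ₗ[ZMod 2] N n :=
  ∑ i : Fin n, TensorProduct.map (contr (LinearMap.proj i))
    (LinearMap.mulLeft (ZMod 2) (MvPolynomial.X i : Y n))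

theorem Q0_tmul {n : ℕ} (a : Lam n) (p : Y n) :
    Q0 n (a ⊗ₜ p) =
      ∑ i : Fin n, contr (LinearMap.proj i) a ⊗ₜ[ZMod 2] (MvPolynomial.X i * p) := by
  simp [Q0, LinearMap.sum_apply]

theorem Q0_y {n : ℕ} (p : Y n) : Q0 n (1 ⊗ₜ p) = 0 := by
  rw [Q0_tmul]
  refine Finset.sum_eq_zero fun i _ => ?_
  rw [show contr (LinearMap.proj i) (1 : Lam n) = 0 from CliffordAlgebra.contractLeft_one _ _,
    TensorProduct.zero_tmul]

theorem Q0_x {n : ℕ} (i : Fin n) : Q0 n (x i ⊗ₜ 1) = 1 ⊗ₜ MvPolynomial.X i := by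
  have h : ∀ j : Fin n, contr (LinearMap.proj j) (x i) = (Pi.single i 1 : Fin n → ZMod 2) j • 1 := by
    intro j
    have := contr_ι_mul (LinearMap.proj j) (Pi.single i 1 : Fin n → ZMod 2) 1
    rwa [mul_one, show contr (LinearMap.proj j) (1 : Lam n) = 0 from
      CliffordAlgebra.contractLeft_one _ _, mul_zero, add_zero] at this
  rw [Q0_tmul, Finset.sum_eq_single i]
  · rw [h]; simp
  · intro j _ hj
    rw [h]; simp [hj]
  · simp

theorem Q0_mul {n : ℕ} (u v : N n) : Q0 n (u * v) = Q0 n u * v + u * Q0 n v := by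
  induction u using TensorProduct.induction_on with
  | zero => simp
  | add u₁ u₂ h₁ h₂ => rw [add_mul, map_add, h₁, h₂, map_add, add_mul, add_mul]; abel
  | tmul a p =>
    induction v using TensorProduct.induction_on with
    | zero => simp
    | add v₁ v₂ h₁ h₂ => rw [mul_add, map_add, h₁, h₂, map_add, mul_add, mul_add]; abel
    | tmul b q =>
      rw [Algebra.TensorProduct.tmul_mul_tmul, Q0_tmul, Q0_tmul, Q0_tmul, Finset.sum_mul,
        Finset.mul_sum, ← Finset.sum_add_distrib]
      refine Finset.sum_congr rfl fun i _ => ?_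
      rw [contr_mul, TensorProduct.add_tmul, Algebra.TensorProduct.tmul_mul_tmul,
        Algebra.TensorProduct.tmul_mul_tmul, mul_assoc, mul_left_comm p]

theorem Q0_mem {n d : ℕ} {u : N n} (hu : u ∈ NDeg n d) : Q0 n u ∈ NDeg n (d + 1) := by
  suffices h : NDeg n d ≤ (NDeg n (d + 1)).comap (Q0 n) from h hu
  refine iSup_le fun a => iSup_le fun b => iSup_le fun hab => ?_
  rintro _ ⟨t, rfl⟩
  rw [Submodule.mem_comap]
  induction t using TensorProduct.induction_on with
  | zero => simp
  | add s t hs ht => rw [map_add, map_add]; exact add_mem hs ht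
  | tmul l p =>
    rw [TensorProduct.map_tmul, Q0_tmul]
    refine Submodule.sum_mem _ fun i _ => ?_
    rcases a with _ | a
    · obtain ⟨l, hl⟩ := l
      rw [LamDeg, ExteriorAlgebra.exteriorPower, pow_zero] at hl
      obtain ⟨r, rfl⟩ := Submodule.mem_one.1 hl
      have : contr (LinearMap.proj i) (algebraMap (ZMod 2) (Lam n) r) = 0 :=
        CliffordAlgebra.contractLeft_algebraMap _ _ r
      simp only [Submodule.subtype_apply]
      rw [this, TensorProduct.zero_tmul]
      exact zero_mem _
    · refine Submodule.mem_iSup_of_mem a (Submodule.mem_iSup_of_mem (b + 1)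
        (Submodule.mem_iSup_of_mem (by omega) ?_))
      refine ⟨⟨_, contr_mem (LinearMap.proj i) a l.2⟩ ⊗ₜ ⟨MvPolynomial.X i * (p : Y n), ?_⟩, rfl⟩
      rw [add_comm b 1]
      exact (MvPolynomial.isHomogeneous_X _ i).mul p.2

/-! ### Reduced powers and weights -/

/-- The total reduced power `∑ₐ tᵃ 𝒫ᵃ : 𝔽₂[y] → 𝔽₂[y][t]`, the ring homomorphism with
`yᵢ ↦ yᵢ + t yᵢ²`; multiplicativity is the Cartan formula. -/
def totalPower (n : ℕ) : Y n →ₐ[ZMod 2] Polynomial (Y n) :=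
  MvPolynomial.aeval fun i =>
    Polynomial.C (MvPolynomial.X i) + Polynomial.X * Polynomial.C (MvPolynomial.X i ^ 2)

/-- The reduced power `𝒫ᵃ` on `𝔽₂[y₁,…,yₙ]`. -/
def redPower (n a : ℕ) : Y n →ₗ[ZMod 2] Y n :=
  ((Polynomial.lcoeff (Y n) a).restrictScalars (ZMod 2)) ∘ₗ (totalPower n).toLinearMap

/-- `P⁺(Y)`: the span of the images of all `𝒫ᵃ` with `a ≥ 1`, hence of all words of positive
degree in the reduced powers. -/
def PPlus (n : ℕ) : Submodule (ZMod 2) (Y n) :=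
  ⨆ (a : ℕ) (_ : 1 ≤ a), LinearMap.range (redPower n a)

/-- The `j`-th binary digit `α_{ij}` of `mᵢ`. For a monomial `x^ε y^e` one takes
`mᵢ = εᵢ + 2 eᵢ`. -/
def alphaBit {n : ℕ} (m : Fin n → ℕ) (i : Fin n) (j : ℕ) : ℕ := m i / 2 ^ j % 2

/-- `αᵢ = ∑ⱼ α_{ij}`, the binary digit sum of `mᵢ`. -/
def alpha {n : ℕ} (m : Fin n → ℕ) (i : Fin n) : ℕ := (Nat.digits 2 (m i)).sum

/-- `ωⱼ = ∑ᵢ α_{ij}`. -/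
def omega {n : ℕ} (m : Fin n → ℕ) (j : ℕ) : ℕ := ∑ i, alphaBit m i j

/-- The subspace `G ⊆ 𝔽₂[y₁,…,yₙ]` spanned by `P⁺(Y)` and by the monomials `y^e` with
`(ω₁,…,ω_k) < (n-1,…,n-1)` lexicographically. -/
def G (n k : ℕ) : Submodule (ZMod 2) (Y n) :=
  PPlus n ⊔ Submodule.span (ZMod 2)
    {p | ∃ e : Fin n →₀ ℕ,
      toLex (fun j : Fin k => omega (fun i => 2 * e i) (j + 1)) < toLex (fun _ => n - 1) ∧
      p = MvPolynomial.monomial e 1}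

/-! ### The local top layer -/

/-- `d₁ = (n-1)(2^k-1)`. -/
def d₁ (n k : ℕ) : ℕ := (n - 1) * (2 ^ k - 1)

/-- `d = k + 2d₁`. -/
def deg (n k : ℕ) : ℕ := k + 2 * d₁ n k

/-- `(Y/G)^{2d₁}`. -/
abbrev YQuot (n k : ℕ) : Type :=
  YDeg n (d₁ n k) ⧸ (G n k).submoduleOf (YDeg n (d₁ n k))

/-- `Λᵏ ⊗ (Y/G)^{2d₁}`. -/
abbrev Top (n k : ℕ) : Type := LamDeg n k ⊗[ZMod 2] YQuot n k

/-- The projection `Λ → Λᵃ`. -/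
def lamProj (n a : ℕ) : Lam n →ₗ[ZMod 2] LamDeg n a :=
  DirectSum.component (ZMod 2) ℕ (fun i => LamDeg n i) a ∘ₗ
    (DirectSum.decomposeLinearEquiv (fun i : ℕ => LamDeg n i)).toLinearMap

/-- The projection `Y → Y^{2b}`. -/
def yProj (n b : ℕ) : Y n →ₗ[ZMod 2] YDeg n b :=
  (MvPolynomial.homogeneousComponent b).codRestrict _
    (fun p => MvPolynomial.homogeneousComponent_mem b p)

/-- The projection `pr_k` of `N` onto its summand `Λᵏ ⊗ Y^{2d₁}`. -/
def pr (n k : ℕ) : N n →ₗ[ZMod 2] LamDeg n k ⊗[ZMod 2] YDeg n (d₁ n k) :=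
  TensorProduct.map (lamProj n k) (yProj n (d₁ n k))

/-- The quotient map `π : Λᵏ ⊗ Y^{2d₁} → Λᵏ ⊗ (Y/G)^{2d₁}`. -/
def proj (n k : ℕ) : LamDeg n k ⊗[ZMod 2] YDeg n (d₁ n k) →ₗ[ZMod 2] Top n k :=
  LinearMap.lTensor _ (Submodule.mkQ _)

/-- The set `mono(k)` of monotone injections `{1,…,k} → {1,…,n}`. -/
abbrev Mono (n k : ℕ) : Type := Fin k ↪o Fin n

/-- The monomial `x_{σ(1)} ⋯ x_{σ(k)} y^e`. -/
def mon {n k : ℕ} (σ : Mono n k) (e : Fin n →₀ ℕ) : N n :=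
  ExteriorAlgebra.ιMulti (ZMod 2) k (fun j => Pi.single (σ j) 1) ⊗ₜ MvPolynomial.monomial e 1

/-- The exponents `εᵢ + 2eᵢ` of the monomial `x_{σ(1)} ⋯ x_{σ(k)} y^e`. -/
def code {n k : ℕ} (σ : Mono n k) (e : Fin n →₀ ℕ) (i : Fin n) : ℕ :=
  (if i ∈ Finset.univ.map σ.toEmbedding then 1 else 0) + 2 * e i

/-- The exponents of the `yᵢ` in `σ(z_k)`: the exponent of `y_{σ(j)}` is `2^k - 2^{k-j} - 1`
for `1 ≤ j ≤ k` (here `j` is counted from `0`), and that of any other `yᵢ` is `2^k - 1`. -/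
def zExp {n k : ℕ} (σ : Mono n k) : Fin n →₀ ℕ :=
  Finsupp.equivFunOnFinite.symm
    (Function.extend σ (fun j : Fin k => 2 ^ k - 2 ^ (k - 1 - (j : ℕ)) - 1) (fun _ => 2 ^ k - 1))

/-- The monotone translate `σ(z_k)`. -/
def z {n k : ℕ} (σ : Mono n k) : N n := mon σ (zExp σ)

/-- `M₀` is a set of monomials `x_{σ(1)} ⋯ x_{σ(k)} y^e` in `Λᵏ ⊗ Y^{2d₁}`, each with `αᵢ < k` for
some `i`, such that the images under `π` of the elements of `M₀` and of the `σ(z_k)`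
together form a basis of `Λᵏ ⊗ (Y/G)^{2d₁}`. -/
structure IsComplementaryBlock (n k : ℕ) (M₀ : Set (Mono n k × (Fin n →₀ ℕ))) : Prop where
  degree_eq : ∀ m ∈ M₀, m.2.degree = d₁ n k
  alpha_lt : ∀ m ∈ M₀, ∃ i, alpha (code m.1 m.2) i < k
  linearIndependent : LinearIndependent (ZMod 2)
    (Sum.elim (fun m : M₀ => proj n k (pr n k (mon m.1.1 m.1.2)))
      (fun σ : Mono n k => proj n k (pr n k (z σ))))
  span_eq_top : Submodule.span (ZMod 2) (Set.range
    (Sum.elim (fun m : M₀ => proj n k (pr n k (mon m.1.1 m.1.2)))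
      (fun σ : Mono n k => proj n k (pr n k (z σ))))) = ⊤

/-- `U₀`, the span of `π(M₀)`. -/
def U₀ (n k : ℕ) (M₀ : Set (Mono n k × (Fin n →₀ ℕ))) : Submodule (ZMod 2) (Top n k) :=
  Submodule.span (ZMod 2) (Set.range fun m : M₀ => proj n k (pr n k (mon m.1.1 m.1.2)))

/-- `V`, the span of the `π(σ(z_k))`. -/
def V (n k : ℕ) : Submodule (ZMod 2) (Top n k) :=
  Submodule.span (ZMod 2) (Set.range fun σ : Mono n k => proj n k (pr n k (z σ)))

namespace IsComplementaryBlock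

variable {n k : ℕ} {M₀ : Set (Mono n k × (Fin n →₀ ℕ))}

theorem isCompl (h : IsComplementaryBlock n k M₀) : IsCompl (V n k) (U₀ n k M₀) := by
  constructor
  · exact (linearIndependent_sum.1 h.linearIndependent).2.2.symm
  · rw [codisjoint_iff, sup_comm, ← h.span_eq_top, Set.Sum.elim_range, Submodule.span_union]
    rfl

/-- The basis `π(σ(z_k))`, `σ ∈ mono(k)`, of `V`. -/
def basis (h : IsComplementaryBlock n k M₀) : Module.Basis (Mono n k) (ZMod 2) (V n k) :=
  Module.Basis.span (linearIndependent_sum.1 h.linearIndependent).2.1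

/-- The identification `V ≅ 𝔽₂^{mono(k)}` sending `π(σ(z_k))` to the standard basis vector. -/
def coords (h : IsComplementaryBlock n k M₀) : V n k ≃ₗ[ZMod 2] (Mono n k → ZMod 2) :=
  h.basis.equivFun

/-- The parity functional `ε : V → 𝔽₂`, the sum of the coordinates. -/
def parity (h : IsComplementaryBlock n k M₀) : V n k →ₗ[ZMod 2] ZMod 2 :=
  ∑ σ, h.basis.coord σ

/-- The local top-layer projection `ϑ = p_{M₁} ∘ π ∘ pr_k : N^{d,*} → V`, where `p_{M₁}` is the
projection onto `V` with kernel `U₀`. -/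
def theta (h : IsComplementaryBlock n k M₀) : NDeg n (deg n k) →ₗ[ZMod 2] V n k :=
  (Submodule.projectionOnto (V n k) (U₀ n k M₀) h.isCompl ∘ₗ proj n k ∘ₗ pr n k).domRestrict
    (NDeg n (deg n k))

end IsComplementaryBlock

/-- `Q₀(N^{d-1,*})` as a subspace of `N^{d,*}`, for `d = k + 2d₁`; see `Q0_image_le`. -/
def Q0Image (n k : ℕ) : Submodule (ZMod 2) (NDeg n (deg n k)) :=
  ((NDeg n (deg n k - 1)).map (Q0 n)).submoduleOf (NDeg n (deg n k))

theorem Q0_image_le {n k : ℕ} (hk : 1 ≤ k) :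
    (NDeg n (deg n k - 1)).map (Q0 n) ≤ NDeg n (deg n k) := by
  rintro _ ⟨u, hu, rfl⟩
  have := Q0_mem hu
  rwa [Nat.sub_add_cancel (by unfold deg; omega)] at this

end MotivicHit

end

noncomputable section

namespace MotivicHit

/-! ### Binary expansions -/

/-! In degree `d₁`, a monomial of `Y` that is not low has exactly one zero in each of its first `k`
binary columns and no digits beyond them. It is therefore `topExp f`, where `f j` is the place of
the zero in column `j` (`exists_eq_topExp`). Next to the exterior factor of `σ`, such a monomial has
all `αᵢ ≥ k` exactly when `f` is a bijection onto the image of `σ` (`all_le_alpha_iff`), and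
`σ(z_k)` is one of these.

For a `k`-set `T`, let `φ_T` add the coefficients at `topExp f` over all bijections `f` onto `T`. It
vanishes on `G`. Low monomials are never of the form `topExp f`. In `𝒫ᵃ(y^e)` with `a ≥ 1`, Lucas'
theorem excludes any contribution if the `e i`, `i ∈ T`, are distinct; if two of them agree,
transposing those two places pairs off the contributions (`topFunctional_redPower`). The `φ_T` thus
give coordinates `topCoords` on the top layer which are dual to the `σ(z_k)` and vanish on every
monomial with some `αᵢ < k`. Hence `dim V = n.choose k`, and `ϑ` in coordinates is `topCoords ∘ π ∘
pr_k` for every complementary block (`coords_theta`).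

Existence of a block needs the converse relation: permuting the columns of `topExp f`, for injective
`f`, does not change its class modulo `G`. For adjacent columns this comes from one explicit reduced
power (`monomial_add_monomial_swap_mem_G`). Every monomial then vanishes, equals some `σ(z_k)`, or
has some `αᵢ < k`, and basis extension applies.

The Bockstein of `x_W y^e` with `|W| = k + 1` has coordinate `φ_{W∖i}(yᵢ y^e)` at the face `W∖i`.
Exchanging the omitted element `i` with the zero of column `0` is a fixed-point-free involution on
the contributions, so their sum is even (`sum_topFunctional_erase`). Conversely, a suitable `e` is
detected by exactly two prescribed faces (`exists_exponent`). Exchanges of one element connect all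
`k`-sets, so these pairs span the even hyperplane. -/

theorem ofBits_eq_sum {k : ℕ} (b : Fin k → Bool) :
    Nat.ofBits b = ∑ j, (b j).toNat * 2 ^ (j : ℕ) := by
  induction k with
  | zero => simp
  | succ k ih =>
    rw [Nat.ofBits_succ, ih, Fin.sum_univ_succ, Finset.mul_sum, add_comm]
    simp [pow_succ]
    exact Finset.sum_congr rfl fun j _ => by ring

theorem sum_digits_eq (k m : ℕ) (hm : m < 2 ^ k) :
    (Nat.digits 2 m).sum = ∑ j : Fin k, (m.testBit j).toNat := by
  induction k generalizing m with
  | zero => simp at hm; simp [hm]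
  | succ k ih =>
    rw [Fin.sum_univ_succ]
    rcases Nat.eq_zero_or_pos m with rfl | h
    · simp
    · rw [Nat.digits_def' (by norm_num) h, List.sum_cons, ih (m / 2) (by omega)]
      simp [Nat.testBit_succ, Nat.testBit_zero]
      rcases Nat.mod_two_eq_zero_or_one m with h | h <;> simp [h]

theorem sum_toNat_add_card {n : ℕ} (b : Fin n → Bool) :
    ∑ i, (b i).toNat + (Finset.univ.filter fun i => b i = false).card = n := by
  rw [Finset.card_filter, ← Finset.sum_add_distrib]
  rw [Finset.sum_congr rfl (g := fun _ => 1)]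
  · simp
  · intro i _; cases b i <;> simp

theorem exists_unique_false {n : ℕ} (hn : 1 ≤ n) (b : Fin n → Bool)
    (h : ∑ i, (b i).toNat = n - 1) : ∃ a, ∀ i, b i = decide (a ≠ i) := by
  have h1 := sum_toNat_add_card b
  have h2 : (Finset.univ.filter fun i => b i = false).card = 1 := by omega
  obtain ⟨a, ha⟩ := Finset.card_eq_one.1 h2
  refine ⟨a, fun i => ?_⟩
  have := Finset.ext_iff.1 ha i
  simp only [Finset.mem_filter, Finset.mem_univ, true_and, Finset.mem_singleton] at this
  cases hb : b i <;> simp [hb] at this ⊢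
  · exact this.symm
  · exact fun h => this h.symm

theorem sum_toNat_decide_ne {n : ℕ} (a : Fin n) :
    ∑ i, (decide (a ≠ i)).toNat = n - 1 := by
  have h := sum_toNat_add_card (fun i => decide (a ≠ i))
  have : (Finset.univ.filter fun i => decide (a ≠ i) = false) = {a} := by
    ext i; simp only [Finset.mem_filter, Finset.mem_univ, true_and, Finset.mem_singleton]
    rw [decide_eq_false_iff_not, not_not, eq_comm]
  rw [this, Finset.card_singleton] at h
  omega

/-! ### Exponents with one missing bit in every column -/

/-- The exponent whose `j`-th binary digit at `i` vanishes exactly if `i = f j`. -/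
def topExp {n k : ℕ} (f : Fin k → Fin n) : Fin n →₀ ℕ :=
  Finsupp.equivFunOnFinite.symm fun i => Nat.ofBits fun j : Fin k => decide (f j ≠ i)

variable {n k : ℕ}

theorem topExp_apply (f : Fin k → Fin n) (i : Fin n) :
    topExp f i = Nat.ofBits fun j : Fin k => decide (f j ≠ i) := rfl

theorem testBit_topExp (f : Fin k → Fin n) (i : Fin n) (j : Fin k) :
    (topExp f i).testBit j = decide (f j ≠ i) := by
  rw [topExp_apply, Nat.testBit_ofBits_lt _ _ j.2]

theorem topExp_lt (f : Fin k → Fin n) (i : Fin n) : topExp f i < 2 ^ k :=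
  Nat.ofBits_lt_two_pow _

theorem eq_of_testBit_fin {a b : ℕ} (ha : a < 2 ^ k) (hb : b < 2 ^ k)
    (h : ∀ j : Fin k, a.testBit j = b.testBit j) : a = b := by
  refine Nat.eq_of_testBit_eq fun j => ?_
  by_cases hj : j < k
  · exact h ⟨j, hj⟩
  · have := Nat.pow_le_pow_right (n := 2) (by norm_num) (not_lt.1 hj)
    rw [Nat.testBit_lt_two_pow (by omega), Nat.testBit_lt_two_pow (by omega)]

theorem eq_topExp {e : Fin n →₀ ℕ} (f : Fin k → Fin n) (hlt : ∀ i, e i < 2 ^ k)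
    (h : ∀ i (j : Fin k), (e i).testBit j = decide (f j ≠ i)) : e = topExp f := by
  ext i
  exact eq_of_testBit_fin (hlt i) (topExp_lt f i) fun j => by rw [h, testBit_topExp]

theorem topExp_injective : Function.Injective (topExp : (Fin k → Fin n) → _) := by
  intro f f' h
  funext j
  have h1 := testBit_topExp f (f' j) j
  rw [h, testBit_topExp] at h1
  simpa using h1

/-- By injectivity, column `s` is the only one with its zero at `f s`. The additive form avoids
truncated subtraction. -/
theorem topExp_apply_self {f : Fin k → Fin n} (hf : f.Injective) (s : Fin k) :
    topExp f (f s) + 2 ^ (s : ℕ) + 1 = 2 ^ k := by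
  have hs : 2 ^ (s : ℕ) < 2 ^ k := Nat.pow_lt_pow_right (by norm_num) s.2
  suffices topExp f (f s) = 2 ^ k - (2 ^ (s : ℕ) + 1) by omega
  refine eq_of_testBit_fin (topExp_lt f _) (Nat.sub_lt (by positivity) (by positivity)) fun j => ?_
  rw [testBit_topExp, Nat.testBit_two_pow_sub_succ hs, Nat.testBit_two_pow]
  simp [hf.eq_iff, Fin.ext_iff, eq_comm]

theorem topExp_apply_of_ne {f : Fin k → Fin n} {i : Fin n} (hi : ∀ s, f s ≠ i) :
    topExp f i + 1 = 2 ^ k := by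
  suffices topExp f i = 2 ^ k - 1 by have := Nat.one_le_two_pow (n := k); omega
  refine eq_of_testBit_fin (topExp_lt f _) (by have := Nat.one_le_two_pow (n := k); omega)
    fun j => ?_
  rw [testBit_topExp, Nat.testBit_two_pow_sub_one]
  simp [hi]

theorem degree_topExp (f : Fin k → Fin n) : (topExp f).degree = d₁ n k := by
  rw [Finsupp.degree_eq_sum]
  simp_rw [topExp_apply, ofBits_eq_sum]
  rw [Finset.sum_comm]
  simp_rw [← Finset.sum_mul, sum_toNat_decide_ne]
  rw [← Finset.mul_sum, d₁, Fin.sum_univ_eq_sum_range (fun j => 2 ^ j) k,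
    Nat.geomSum_eq (le_refl 2)]
  simp

/-- The exponent at `σ j` lacks the bit `k - 1 - j`, so the columns run through `σ` backwards. -/
theorem zExp_eq_topExp (σ : Mono n k) : zExp σ = topExp (σ ∘ Fin.rev) := by
  have hinj : Function.Injective (σ ∘ Fin.rev) := σ.injective.comp Fin.rev_injective
  ext i
  rw [zExp, Finsupp.equivFunOnFinite_symm_apply_apply]
  by_cases hi : ∃ j, σ j = i
  · obtain ⟨j, rfl⟩ := hi
    rw [σ.injective.extend_apply]
    have := topExp_apply_self hinj j.rev
    simp only [Function.comp_apply, Fin.rev_rev, Fin.val_rev] at this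
    rw [show k - 1 - (j : ℕ) = k - (j + 1) by omega]
    omega
  · rw [Function.extend_apply' _ _ _ hi]
    have := topExp_apply_of_ne (f := σ ∘ Fin.rev) (i := i) fun s hs => hi ⟨_, hs⟩
    omega

/-! ### Weights -/

/-- The condition on exponents that defines the low monomials in `G`. -/
def IsLow (k : ℕ) (e : Fin n →₀ ℕ) : Prop :=
  toLex (fun j : Fin k => omega (fun i => 2 * e i) (j + 1)) < toLex (fun _ => n - 1)

theorem omega_two_mul (e : Fin n → ℕ) (j : ℕ) :
    omega (fun i => 2 * e i) (j + 1) = ∑ i, ((e i).testBit j).toNat := by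
  refine Finset.sum_congr rfl fun i _ => ?_
  rw [alphaBit, Nat.toNat_testBit, pow_succ', Nat.mul_div_mul_left _ _ (by norm_num)]

theorem isLow_iff (e : Fin n →₀ ℕ) : IsLow k e ↔
    ∃ j : Fin k, (∀ j' < j, ∑ i, ((e i).testBit j').toNat = n - 1) ∧
      ∑ i, ((e i).testBit j).toNat < n - 1 := by
  simp_rw [← omega_two_mul]
  exact Iff.rfl

theorem not_isLow_topExp (f : Fin k → Fin n) : ¬ IsLow k (topExp f) := by
  rw [isLow_iff]
  rintro ⟨j, -, h⟩
  simp_rw [testBit_topExp, sum_toNat_decide_ne] at h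
  omega

/-- Columns are peeled off from the lowest. If all earlier weights are `n - 1`, not being low leaves
only `n - 1` or `n` for the next one, and the parity of the remaining degree excludes `n`. After `k`
columns the remaining degree is zero. -/
theorem exists_eq_topExp (hn : 1 ≤ n) {e : Fin n →₀ ℕ} (hd : e.degree = d₁ n k)
    (hl : ¬ IsLow k e) : ∃ f : Fin k → Fin n, e = topExp f := by
  rw [isLow_iff] at hl
  push Not at hl
  have key : ∀ j ≤ k, (∀ j' < j, ∑ i, ((e i).testBit j').toNat = n - 1) ∧
      ∑ i, e i / 2 ^ j = (n - 1) * (2 ^ (k - j) - 1) := by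
    intro j
    induction j with
    | zero =>
      intro _
      refine ⟨fun j' h => absurd h (Nat.not_lt_zero _), ?_⟩
      rw [Finsupp.degree_eq_sum] at hd
      simpa [d₁] using hd
    | succ j ih =>
      intro hj
      obtain ⟨h1, h2⟩ := ih (by omega)
      have h3 := hl ⟨j, hj⟩ fun j' hj' => h1 j' hj'
      have h4 := sum_toNat_add_card fun i => (e i).testBit j
      have h5 : ∑ i, e i / 2 ^ j = ∑ i, ((e i).testBit j).toNat + 2 * ∑ i, e i / 2 ^ (j + 1) := by
        rw [Finset.mul_sum, ← Finset.sum_add_distrib]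
        refine Finset.sum_congr rfl fun i _ => ?_
        rw [Nat.toNat_testBit, pow_succ, ← Nat.div_div_eq_div_mul]
        omega
      obtain ⟨m, hm⟩ : ∃ m, k - j = m + 1 := ⟨k - j - 1, by omega⟩
      have h6 : (n - 1) * (2 ^ (k - j) - 1) = (n - 1) + 2 * ((n - 1) * (2 ^ (k - (j + 1)) - 1)) := by
        rw [show k - (j + 1) = m by omega, hm, pow_succ]
        obtain ⟨q, hq⟩ : ∃ q, 2 ^ m = q + 1 := ⟨2 ^ m - 1, by have := Nat.one_le_two_pow (n := m); omega⟩
        rw [hq, show (q + 1) * 2 - 1 = 1 + 2 * q by omega, Nat.add_sub_cancel]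
        ring
      simp only at h3
      have h7 : ∑ i, ((e i).testBit j).toNat = n - 1 := by omega
      refine ⟨fun j' hj' => ?_, by omega⟩
      rcases Nat.lt_succ_iff_lt_or_eq.1 hj' with h | rfl
      · exact h1 j' h
      · exact h7
  obtain ⟨h1, h2⟩ := key k le_rfl
  choose f hf using fun j : Fin k => exists_unique_false hn _ (h1 j j.2)
  refine ⟨f, eq_topExp f (fun i => ?_) fun i j => hf j i⟩
  have h3 : e i / 2 ^ k = 0 := by
    simp only [Nat.sub_self, pow_zero, mul_zero] at h2
    exact Finset.sum_eq_zero_iff.1 h2 i (Finset.mem_univ i)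
  simpa [Nat.div_eq_zero_iff] using h3

/-- The exterior factor supplies digit `0`; of the other `k` digits, one is lost for each column
with its zero at `i`. -/
theorem alpha_code_topExp (σ : Mono n k) (f : Fin k → Fin n) (i : Fin n) :
    alpha (code σ (topExp f)) i + (Finset.univ.filter fun j => f j = i).card =
      (if i ∈ Finset.univ.map σ.toEmbedding then 1 else 0) + k := by
  have h2 := sum_toNat_add_card (fun j => decide (f j ≠ i))
  have h1 : (Finset.univ.filter fun j => decide (f j ≠ i) = false) =
      Finset.univ.filter fun j => f j = i := by
    ext j; simp
  rw [h1] at h2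
  have h3 : ∀ c m : ℕ, c ≤ 1 → (Nat.digits 2 (c + 2 * m)).sum = c + (Nat.digits 2 m).sum := by
    intro c m hc
    rcases Nat.eq_zero_or_pos (c + 2 * m) with h | h
    · obtain ⟨rfl, rfl⟩ : c = 0 ∧ m = 0 := by omega
      simp
    · rw [Nat.digits_def' (by norm_num) h, List.sum_cons]
      congr 1
      · omega
      · congr 2; omega
  rw [alpha, code, h3 _ _ (by split_ifs <;> omega), sum_digits_eq k _ (topExp_lt f i)]
  simp_rw [testBit_topExp]
  omega

/-- Injective maps with values in the `k`-set `T` hit every element of `T`. -/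
theorem exists_eq_of_injective {T : Finset (Fin n)} (hT : T.card = k) {f : Fin k → Fin n}
    (hf : f.Injective) (hfT : ∀ s, f s ∈ T) {i : Fin n} (hi : i ∈ T) : ∃ s, f s = i := by
  have : Finset.univ.image f = T := by
    refine Finset.eq_of_subset_of_card_le (by simpa [Finset.subset_iff] using hfT) ?_
    rw [Finset.card_image_of_injective _ hf, hT]; simp
  rw [← this] at hi
  simpa using hi

theorem all_le_alpha_iff (σ : Mono n k) (f : Fin k → Fin n) :
    (∀ i, k ≤ alpha (code σ (topExp f)) i) ↔
      f.Injective ∧ ∀ s, f s ∈ Finset.univ.map σ.toEmbedding := by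
  constructor
  · intro h
    constructor
    · intro s s' hs
      by_contra hne
      have h1 := alpha_code_topExp σ f (f s)
      have h2 := h (f s)
      have h3 : 1 < (Finset.univ.filter fun j => f j = f s).card :=
        Finset.one_lt_card.2 ⟨s, by simp, s', by simp [hs], hne⟩
      split_ifs at h1 <;> omega
    · intro s
      by_contra hs
      have h1 := alpha_code_topExp σ f (f s)
      have h2 := h (f s)
      have h3 : 0 < (Finset.univ.filter fun j => f j = f s).card :=
        Finset.card_pos.2 ⟨s, by simp⟩
      rw [if_neg hs] at h1
      omega
  · rintro ⟨h1, h2⟩ i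
    have h3 := alpha_code_topExp σ f i
    have h4 : (Finset.univ.filter fun j => f j = i).card ≤ 1 :=
      Finset.card_le_one.2 fun a ha b hb => h1 (by simp at ha hb; rw [ha, hb])
    split_ifs at h3 with hi
    · omega
    · have : (Finset.univ.filter fun j => f j = i).card = 0 := by
        rw [Finset.card_eq_zero, Finset.filter_eq_empty_iff]
        rintro s - rfl
        exact hi (h2 s)
      omega

/-! ### Reduced powers of monomials -/

theorem totalPower_monomial (e : Fin n →₀ ℕ) :
    totalPower n (MvPolynomial.monomial e 1) =
      ∑ t ∈ Fintype.piFinset fun i => Finset.range (e i + 1),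
        Polynomial.monomial (∑ i, t i) (MvPolynomial.monomial
          (e + Finsupp.equivFunOnFinite.symm t) (∏ i, ((e i).choose (t i) : ZMod 2))) := by
  rw [totalPower, MvPolynomial.aeval_monomial, map_one, one_mul,
    Finsupp.prod_fintype _ _ (fun i => pow_zero _)]
  have h : ∀ i, (Polynomial.C (MvPolynomial.X i) +
      Polynomial.X * Polynomial.C (MvPolynomial.X i ^ 2) : Polynomial (Y n)) ^ e i =
      ∑ t ∈ Finset.range (e i + 1), Polynomial.monomial t
        (MvPolynomial.monomial (Finsupp.single i (e i + t)) ((e i).choose t : ZMod 2)) := by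
    intro i
    rw [add_comm, add_pow]
    refine Finset.sum_congr rfl fun t ht => ?_
    obtain ⟨r, hr⟩ : ∃ r, e i = t + r := ⟨e i - t, by simp at ht; omega⟩
    rw [mul_pow, ← Polynomial.C_pow, ← Polynomial.C_pow, hr, Nat.add_sub_cancel_left,
      mul_assoc, mul_assoc, ← Polynomial.C_eq_natCast, ← Polynomial.C_mul, ← Polynomial.C_mul,
      mul_comm, Polynomial.C_mul_X_pow_eq_monomial]
    congr 1
    rw [← pow_mul, ← mul_assoc, ← pow_add, MvPolynomial.X_pow_eq_monomial,
      ← map_natCast (MvPolynomial.C : ZMod 2 →+* Y n), mul_comm, MvPolynomial.C_mul_monomial,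
      mul_one]
    congr 2; ring_nf
  rw [Finset.prod_congr rfl fun i _ => h i, Finset.prod_univ_sum]
  refine Finset.sum_congr rfl fun t _ => ?_
  have h2 : ∀ s : Finset (Fin n), ∏ i ∈ s, Polynomial.monomial (t i) (MvPolynomial.monomial
      (Finsupp.single i (e i + t i)) ((e i).choose (t i) : ZMod 2)) =
      Polynomial.monomial (∑ i ∈ s, t i) (MvPolynomial.monomial
        (∑ i ∈ s, Finsupp.single i (e i + t i)) (∏ i ∈ s, ((e i).choose (t i) : ZMod 2))) := by
    intro s
    induction s using Finset.induction_on with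
    | empty => simp
    | insert a s ha ih =>
      rw [Finset.prod_insert ha, ih, Polynomial.monomial_mul_monomial,
        MvPolynomial.monomial_mul, Finset.sum_insert ha, Finset.sum_insert ha,
        Finset.prod_insert ha]
  rw [h2]
  have h3 : ∑ i, Finsupp.single i (e i + t i) = e + Finsupp.equivFunOnFinite.symm t := by
    ext i
    simp [-Finsupp.single_add, Finsupp.finsetSum_apply, Finsupp.single_apply]
  rw [h3]

theorem redPower_monomial (a : ℕ) (e : Fin n →₀ ℕ) :
    redPower n a (MvPolynomial.monomial e 1) =
      ∑ t ∈ (Fintype.piFinset fun i => Finset.range (e i + 1)) with ∑ i, t i = a,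
        MvPolynomial.monomial (e + Finsupp.equivFunOnFinite.symm t)
          (∏ i, ((e i).choose (t i) : ZMod 2)) := by
  rw [redPower, LinearMap.comp_apply]
  simp only [AlgHom.toLinearMap_apply, LinearMap.coe_restrictScalars, totalPower_monomial,
    Polynomial.lcoeff_apply, Polynomial.finsetSum_coeff, Polynomial.coeff_monomial]
  rw [Finset.sum_filter]

/-- Only the increment `g - e` can lead from `e` to `g`; if it exceeds `e` at some place, the
binomial coefficient is already zero. -/
theorem coeff_redPower_monomial (a : ℕ) (e g : Fin n →₀ ℕ) :
    MvPolynomial.coeff g (redPower n a (MvPolynomial.monomial e 1)) =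
      if e ≤ g ∧ g.degree = e.degree + a then
        ∏ i, ((e i).choose (g i - e i) : ZMod 2) else 0 := by
  rw [redPower_monomial, MvPolynomial.coeff_sum]
  simp_rw [MvPolynomial.coeff_monomial]
  have hdeg : ∀ t : Fin n → ℕ, (e + Finsupp.equivFunOnFinite.symm t).degree =
      e.degree + ∑ i, t i := by
    intro t
    rw [map_add, Finsupp.degree_eq_sum (Finsupp.equivFunOnFinite.symm t)]
    rfl
  split_ifs with h
  · obtain ⟨h1, h2⟩ := h
    set t : Fin n → ℕ := fun i => g i - e i with ht
    have hg : e + Finsupp.equivFunOnFinite.symm t = g := by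
      ext i
      have := h1 i
      simp [ht]
      omega
    have hta : ∑ i, t i = a := by
      have := hdeg t
      rw [hg] at this
      omega
    have huniq : ∀ t', e + Finsupp.equivFunOnFinite.symm t' = g → t' = t := by
      intro t' h'
      rw [← hg] at h'
      simpa using h'
    by_cases hmem : ∀ i, t i ≤ e i
    · rw [Finset.sum_eq_single t, if_pos hg]
      · intro t' _ hne
        exact if_neg fun h' => hne (huniq t' h')
      · intro hn
        refine absurd ?_ hn
        simp only [Finset.mem_filter, Fintype.mem_piFinset, Finset.mem_range]
        exact ⟨fun i => Nat.lt_succ_of_le (hmem i), hta⟩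
    · push Not at hmem
      obtain ⟨i, hi⟩ := hmem
      rw [Finset.prod_eq_zero (Finset.mem_univ i)]
      · refine Finset.sum_eq_zero fun t' ht' => if_neg fun h' => ?_
        rw [huniq t' h'] at ht'
        simp only [Finset.mem_filter, Fintype.mem_piFinset, Finset.mem_range] at ht'
        have := ht'.1 i
        omega
      · rw [Nat.choose_eq_zero_of_lt hi, Nat.cast_zero]
  · refine Finset.sum_eq_zero fun t ht => if_neg fun h' => h ?_
    simp only [Finset.mem_filter] at ht
    rw [← h', hdeg, ht.2]
    exact ⟨le_self_add, rfl⟩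

/-! ### Odd binomial coefficients -/

theorem odd_choose_iff (e t : ℕ) : Odd (e.choose t) ↔
    (t % 2 = 1 → e % 2 = 1) ∧ Odd ((e / 2).choose (t / 2)) := by
  have h := Choose.choose_modEq_choose_mod_mul_choose_div_nat (p := 2) (n := e) (k := t)
  rw [Nat.odd_iff, h, ← Nat.odd_iff, Nat.odd_mul]
  refine and_congr_left fun _ => ?_
  rcases Nat.mod_two_eq_zero_or_one e with h1 | h1 <;>
    rcases Nat.mod_two_eq_zero_or_one t with h2 | h2 <;> rw [h1, h2] <;> decide

theorem testBit_of_odd_choose {e t : ℕ} (h : Odd (e.choose t)) (j : ℕ)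
    (hj : t.testBit j = true) : e.testBit j = true := by
  induction j generalizing e t with
  | zero =>
    have := (odd_choose_iff e t).1 h
    simp only [Nat.testBit_zero, decide_eq_true_eq] at hj ⊢
    exact this.1 hj
  | succ j ih =>
    rw [Nat.testBit_succ] at hj ⊢
    exact ih ((odd_choose_iff e t).1 h).2 hj

/-- By Lucas, the digits of `t` are among those of `e`. Since `e + t` is odd, the odd one is `e`,
and the halves satisfy the same equation. -/
theorem eq_zero_of_odd_choose {e t : ℕ} (h : Odd (e.choose t)) (hs : e + t + 1 = 2 ^ k) :
    t = 0 := by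
  induction k generalizing e t with
  | zero => omega
  | succ k ih =>
    rw [odd_choose_iff] at h
    rw [pow_succ] at hs
    have := ih h.2 (by omega)
    omega

/-- Under a Lucas-admissible increment, a number with the single zero digit `s` can only come from
one with a single zero digit `u ≥ s`. Digits below `s` are stripped by halving. At digit `s`, either
`e` and `t` are both even and the rest of `t` vanishes, or both are odd and the carry reproduces the
problem with `s = 0`. -/
theorem exists_eq_of_odd_choose {s : ℕ} (hsk : s < k) {e t : ℕ} (h : Odd (e.choose t))
    (hs : e + t + 2 ^ s + 1 = 2 ^ k) : ∃ u, s ≤ u ∧ u < k ∧ e + 2 ^ u + 1 = 2 ^ k := by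
  induction k generalizing s e t with
  | zero => omega
  | succ k ih =>
    rw [odd_choose_iff] at h
    rw [pow_succ] at hs
    rcases s with _ | s
    · rw [pow_zero] at hs
      by_cases ht : t % 2 = 1
      · have he := h.1 ht
        have hk : 0 < k := by
          rcases k with _ | k
          · omega
          · omega
        obtain ⟨u, -, hu, hu'⟩ := ih hk h.2 (by omega)
        refine ⟨u + 1, by omega, by omega, ?_⟩
        rw [pow_succ, pow_succ]
        omega
      · have := eq_zero_of_odd_choose (k := k) h.2 (by omega)
        exact ⟨0, le_rfl, by omega, by rw [pow_succ, pow_zero]; omega⟩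
    · rw [pow_succ] at hs
      have hp := Nat.one_le_two_pow (n := s)
      obtain ⟨u, h1, h2, h3⟩ := ih (s := s) (by omega) h.2 (by omega)
      exact ⟨u + 1, by omega, by omega, by rw [pow_succ, pow_succ]; omega⟩

/-! ### The functionals detecting the top classes -/

/-- The functional on `𝔽₂[y]` that counts, modulo two, the monomials whose columns miss
distinct elements of `T`. -/
def topFunctional (k : ℕ) (T : Finset (Fin n)) : Y n →ₗ[ZMod 2] ZMod 2 :=
  ∑ f : Fin k → Fin n with f.Injective ∧ ∀ s, f s ∈ T, MvPolynomial.lcoeff (ZMod 2) (topExp f)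

theorem topFunctional_apply (T : Finset (Fin n)) (p : Y n) : topFunctional k T p =
    ∑ f : Fin k → Fin n with f.Injective ∧ ∀ s, f s ∈ T, MvPolynomial.coeff (topExp f) p := by
  rw [topFunctional, LinearMap.sum_apply]
  rfl

theorem topFunctional_monomial_of_ne (T : Finset (Fin n)) (e : Fin n →₀ ℕ)
    (h : ∀ f : Fin k → Fin n, f.Injective → (∀ s, f s ∈ T) → e ≠ topExp f) :
    topFunctional k T (MvPolynomial.monomial e 1) = 0 := by
  rw [topFunctional_apply]
  refine Finset.sum_eq_zero fun f hf => ?_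
  simp only [Finset.mem_filter, Finset.mem_univ, true_and] at hf
  rw [MvPolynomial.coeff_monomial, if_neg (h f hf.1 hf.2)]

theorem topFunctional_monomial_topExp (T : Finset (Fin n)) {f : Fin k → Fin n}
    (hf : f.Injective) (hfT : ∀ s, f s ∈ T) :
    topFunctional k T (MvPolynomial.monomial (topExp f) 1) = 1 := by
  rw [topFunctional_apply, Finset.sum_eq_single f]
  · rw [MvPolynomial.coeff_monomial, if_pos rfl]
  · intro f' _ hne
    rw [MvPolynomial.coeff_monomial, if_neg fun h => hne (topExp_injective h).symm]
  · intro h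
    simp only [Finset.mem_filter, Finset.mem_univ, true_and] at h
    exact absurd ⟨hf, hfT⟩ h

theorem topExp_swap (f : Fin k → Fin n) (a b i : Fin n) :
    topExp (Equiv.swap a b ∘ f) i = topExp f (Equiv.swap a b i) := by
  rw [topExp_apply, topExp_apply]
  congr 1
  funext j
  congr 1
  rw [ne_eq, ne_eq, Function.comp_apply, Equiv.swap_apply_eq_iff]

/-- The exponents of a monomial with a nonzero contribution to a top monomial under a
reduced power form a permuted top exponent, or have a repetition in `T`. -/
theorem eq_topExp_of_odd_choose {T : Finset (Fin n)} {e : Fin n →₀ ℕ}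
    {f : Fin k → Fin n} (hf : f.Injective) (hfT : ∀ s, f s ∈ T)
    (he : ∀ i ∈ T, ∀ j ∈ T, e i = e j → i = j) (hle : e ≤ topExp f)
    (hodd : ∀ i, Odd ((e i).choose (topExp f i - e i))) : e = topExp f := by
  have h1 : ∀ s, ∃ u : Fin k, s ≤ u ∧ e (f s) + 2 ^ (u : ℕ) + 1 = 2 ^ k := by
    intro s
    have h := topExp_apply_self hf s
    have h' := hle (f s)
    obtain ⟨u, h1, h2, h3⟩ := exists_eq_of_odd_choose s.2 (hodd (f s)) (by omega)
    exact ⟨⟨u, h2⟩, h1, h3⟩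
  choose u hu hu' using h1
  have hinj : u.Injective := by
    intro s s' h
    refine hf (he _ (hfT s) _ (hfT s') ?_)
    have h1 := hu' s
    have h2 := hu' s'
    rw [h] at h1
    omega
  have hbij := Finite.injective_iff_bijective.1 hinj
  -- A permutation `u` with `s ≤ u s` for all `s` is the identity, by comparing sums.
  have hsum : ∑ s : Fin k, (s : ℕ) = ∑ s, (u s : ℕ) :=
    (hbij.sum_comp fun s : Fin k => (s : ℕ)).symm
  have hus : ∀ s : Fin k, (s : ℕ) = u s := by
    intro s
    exact (Finset.sum_eq_sum_iff_of_le fun s _ => Fin.le_def.1 (hu s)).1 hsum s (Finset.mem_univ s)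
  ext i
  by_cases hi : ∃ s, f s = i
  · obtain ⟨s, rfl⟩ := hi
    have h1 := hu' s
    have h2 := topExp_apply_self hf s
    rw [← hus] at h1
    omega
  · push Not at hi
    have h1 := topExp_apply_of_ne hi
    have h2 := hle i
    have := eq_zero_of_odd_choose (k := k) (hodd i) (by omega)
    omega

/-- If `e` is injective on `T`, a contribution would force `e = topExp f`, contradicting the degree
shift `a ≥ 1`. Otherwise a transposition fixing `e` cancels the contributions in pairs. -/
theorem topFunctional_redPower {T : Finset (Fin n)} (hT : T.card = k) {a : ℕ} (ha : 1 ≤ a)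
    (p : Y n) : topFunctional k T (redPower n a p) = 0 := by
  suffices h : topFunctional k T ∘ₗ redPower n a = 0 from LinearMap.congr_fun h p
  refine (MvPolynomial.basisMonomials (Fin n) (ZMod 2)).ext fun e => ?_
  simp only [MvPolynomial.coe_basisMonomials, LinearMap.comp_apply, LinearMap.zero_apply, topFunctional_apply,
    coeff_redPower_monomial]
  by_cases hinj : ∀ i ∈ T, ∀ j ∈ T, e i = e j → i = j
  · refine Finset.sum_eq_zero fun f hf => ?_
    simp only [Finset.mem_filter, Finset.mem_univ, true_and] at hf
    split_ifs with h
    · by_contra hne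
      have := eq_topExp_of_odd_choose hf.1 hf.2 hinj h.1 fun i => by
        have := Finset.prod_ne_zero_iff.1 hne i (Finset.mem_univ i)
        rwa [ZMod.natCast_ne_zero_iff_odd] at this
      rw [← this] at h
      omega
    · rfl
  · push Not at hinj
    obtain ⟨i, hi, j, hj, hij, hne⟩ := hinj
    have hsw : ∀ r, e (Equiv.swap i j r) = e r := by
      intro r
      rw [Equiv.swap_apply_def]
      split_ifs with h1 h2
      · rw [h1, hij]
      · rw [h2, hij]
      · rfl
    -- There is no fixed point: since `T` has `k` elements, `f` attains the value `i`, which the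
    -- transposition moves.
    refine Finset.sum_involution (fun f _ => Equiv.swap i j ∘ f) ?_ ?_ ?_ ?_
    · intro f _
      have h1 : (e ≤ topExp (Equiv.swap i j ∘ f)) ↔ e ≤ topExp f := by
        constructor
        · intro h r
          have := h (Equiv.swap i j r)
          rwa [topExp_swap, hsw, Equiv.swap_apply_self] at this
        · intro h r
          rw [topExp_swap, ← hsw r]
          exact h _
      have h2 : ∏ r, ((e r).choose (topExp (Equiv.swap i j ∘ f) r - e r) : ZMod 2) =
          ∏ r, ((e r).choose (topExp f r - e r) : ZMod 2) := by
        refine Fintype.prod_equiv (Equiv.swap i j) _ _ fun r => ?_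
        rw [topExp_swap, hsw]
      simp only [h1, h2, degree_topExp]
      exact CharTwo.add_self_eq_zero _
    · intro f hf _ h
      simp only [Finset.mem_filter, Finset.mem_univ, true_and] at hf
      obtain ⟨s, hs⟩ := exists_eq_of_injective hT hf.1 hf.2 hi
      have := congrFun h s
      rw [Function.comp_apply, hs, Equiv.swap_apply_left] at this
      exact hne this.symm
    · intro f hf
      simp only [Finset.mem_filter, Finset.mem_univ, true_and] at hf ⊢
      refine ⟨(Equiv.swap i j).injective.comp hf.1, fun s => ?_⟩
      rw [Function.comp_apply, Equiv.swap_apply_def]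
      split_ifs
      · exact hj
      · exact hi
      · exact hf.2 s
    · intro f _
      funext s
      simp

theorem topFunctional_eq_zero_of_mem {T : Finset (Fin n)} (hT : T.card = k) {p : Y n}
    (hp : p ∈ G n k) : topFunctional k T p = 0 := by
  suffices h : G n k ≤ LinearMap.ker (topFunctional k T) from h hp
  refine sup_le (iSup₂_le fun a ha => ?_) (Submodule.span_le.2 ?_)
  · rintro _ ⟨p, rfl⟩
    exact topFunctional_redPower hT ha p
  · rintro _ ⟨e, he, rfl⟩
    refine topFunctional_monomial_of_ne T e fun f _ _ hef => ?_
    exact not_isLow_topExp f (hef ▸ he)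

/-! ### Reordering columns modulo hit polynomials -/

theorem odd_choose_two_pow {m j : ℕ} (h : m.testBit j = true) : Odd (m.choose (2 ^ j)) := by
  induction j generalizing m with
  | zero =>
    rw [pow_zero, Nat.choose_one_right, Nat.odd_iff]
    simpa using h
  | succ j ih =>
    rw [odd_choose_iff, pow_succ]
    rw [Nat.testBit_succ] at h
    refine ⟨fun h' => by omega, ?_⟩
    rw [Nat.mul_div_cancel _ (by norm_num)]
    exact ih h

theorem testBit_add_of_dvd {t : ℕ} (m s : ℕ) (h : 2 ^ s ∣ t) :
    (m + t).testBit s = (m.testBit s ^^ t.testBit s) := by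
  obtain ⟨q, rfl⟩ := h
  rw [Nat.testBit_eq_decide_div_mod_eq, Nat.testBit_eq_decide_div_mod_eq,
    Nat.testBit_eq_decide_div_mod_eq, Nat.add_mul_div_left _ _ (by positivity),
    Nat.mul_div_cancel_left _ (by positivity)]
  rcases Nat.mod_two_eq_zero_or_one (m / 2 ^ s) with h1 | h1 <;>
    rcases Nat.mod_two_eq_zero_or_one q with h2 | h2 <;> simp [Nat.add_mod, h1, h2]

/-- A single carry: adding `2 ^ j` to the digits `1, 0` in positions `j, j + 1` gives `0, 1`. -/
theorem ofBits_add_two_pow {b b' : Fin k → Bool} {j j' : Fin k} (hj : (j' : ℕ) = j + 1)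
    (h : ∀ s, s ≠ j → s ≠ j' → b s = b' s) (h1 : b j = true) (h2 : b j' = false)
    (h3 : b' j = false) (h4 : b' j' = true) : Nat.ofBits b + 2 ^ (j : ℕ) = Nat.ofBits b' := by
  have hne : j' ≠ j := fun h => by rw [h] at hj; omega
  have hmem : j' ∈ Finset.univ.erase j := by simp [hne]
  rw [ofBits_eq_sum, ofBits_eq_sum, ← Finset.add_sum_erase _ _ (Finset.mem_univ j),
    ← Finset.add_sum_erase _ _ hmem, ← Finset.add_sum_erase _ (fun s => (b' s).toNat * _)
    (Finset.mem_univ j), ← Finset.add_sum_erase _ (fun s => (b' s).toNat * _) hmem, h1, h2, h3, h4,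
    hj]
  have : ∑ s ∈ (Finset.univ.erase j).erase j', (b s).toNat * 2 ^ (s : ℕ) =
      ∑ s ∈ (Finset.univ.erase j).erase j', (b' s).toNat * 2 ^ (s : ℕ) := by
    refine Finset.sum_congr rfl fun s hs => ?_
    simp only [Finset.mem_erase] at hs
    rw [h s hs.2.1 hs.1]
  rw [this]
  simp only [Bool.toNat_true, Bool.toNat_false]
  ring

theorem exists_eq_single_of_dvd {t : Fin n → ℕ} {q : ℕ} (hq : 0 < q) (hs : ∑ i, t i = q)
    (hd : ∀ i, q ∣ t i) : ∃ c, t = Pi.single c q := by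
  obtain ⟨c, hc⟩ : ∃ c, t c ≠ 0 := by
    by_contra! h
    rw [Finset.sum_eq_zero fun i _ => h i] at hs
    omega
  have h1 := Nat.le_of_dvd (Nat.pos_of_ne_zero hc) (hd c)
  rw [← Finset.add_sum_erase _ _ (Finset.mem_univ c)] at hs
  have h2 : ∑ i ∈ Finset.univ.erase c, t i = 0 := by omega
  refine ⟨c, funext fun i => ?_⟩
  by_cases hi : i = c
  · subst hi
    rw [Pi.single_eq_same]
    omega
  · rw [Pi.single_eq_of_ne hi]
    exact Finset.sum_eq_zero_iff.1 h2 i (by simp [hi])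

theorem mem_G_of_coeff {p : Y n} (h : ∀ g, MvPolynomial.coeff g p ≠ 0 → IsLow k g) :
    p ∈ G n k := by
  refine Submodule.mem_sup_right ?_
  rw [p.as_sum]
  refine Submodule.sum_mem _ fun g hg => ?_
  have hg := MvPolynomial.mem_support_iff.1 hg
  have h1 : MvPolynomial.coeff g p = 1 := by
    generalize MvPolynomial.coeff g p = c at hg
    revert c; decide
  rw [h1]
  exact Submodule.subset_span ⟨g, h g hg, rfl⟩

/-- The two monomials are the only terms of `𝒫^{2^j}(y^m)` that are not low, for an `m` whose column
`j` is full and whose column `j + 1` has zeros at both `f j` and `f j'`. -/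
theorem monomial_add_monomial_swap_mem_G (hn : 1 ≤ n) (f : Fin k → Fin n) {j j' : Fin k}
    (hj : (j' : ℕ) = j + 1) (hf : f j ≠ f j') :
    MvPolynomial.monomial (topExp f) 1 + MvPolynomial.monomial (topExp (f ∘ Equiv.swap j j')) 1 ∈
      G n k := by
  have hne : j' ≠ j := fun h => by rw [h] at hj; omega
  -- Adding `2 ^ j` at `f j` or at `f j'` carries into column `j + 1`, producing `topExp f` or its
  -- swapped version.
  obtain ⟨m, hm⟩ : ∃ m : Fin n →₀ ℕ, ∀ i, m i = Nat.ofBits fun s : Fin k =>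
      if s = j then true else if s = j' then decide (f j ≠ i ∧ f j' ≠ i) else decide (f s ≠ i) :=
    ⟨Finsupp.equivFunOnFinite.symm _, fun i => rfl⟩
  have hbit : ∀ i (s : Fin k), (m i).testBit s =
      if s = j then true else if s = j' then decide (f j ≠ i ∧ f j' ≠ i)
        else decide (f s ≠ i) := by
    intro i s
    rw [hm, Nat.testBit_ofBits_lt _ _ s.2]
  have hsame : ∀ i, f j ≠ i → f j' ≠ i → m i = topExp f i := by
    intro i h1 h2
    rw [hm, topExp_apply]
    congr 1
    funext s
    split_ifs with h3 h4
    · simp [h3, h1]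
    · simp [h4, h1, h2]
    · rfl
  have hsame' : ∀ i, f j ≠ i → f j' ≠ i → m i = topExp (f ∘ Equiv.swap j j') i := by
    intro i h1 h2
    rw [hm, topExp_apply]
    congr 1
    funext s
    split_ifs with h3 h4
    · simp [h3, h2]
    · simp [h4, h1, h2]
    · rw [Function.comp_apply, Equiv.swap_apply_of_ne_of_ne h3 h4]
  have hma : m + Finsupp.single (f j) (2 ^ (j : ℕ)) = topExp f := by
    ext i
    rw [Finsupp.add_apply]
    by_cases hi : f j = i
    · subst hi
      rw [Finsupp.single_eq_same, hm, topExp_apply]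
      refine ofBits_add_two_pow hj (fun s h1 h2 => ?_) ?_ ?_ ?_ ?_
      · simp [h1, h2]
      · simp
      · simp [hne]
      · simp
      · simp [hf.symm]
    · rw [Finsupp.single_eq_of_ne (Ne.symm hi), add_zero]
      by_cases hi' : f j' = i
      · subst hi'
        rw [hm, topExp_apply]
        congr 1
        funext s
        split_ifs with h3 h4
        · simp [h3, hf]
        · simp [h4]
        · rfl
      · exact hsame i hi hi'
  have hmb : m + Finsupp.single (f j') (2 ^ (j : ℕ)) = topExp (f ∘ Equiv.swap j j') := by
    ext i
    rw [Finsupp.add_apply]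
    by_cases hi : f j' = i
    · subst hi
      rw [Finsupp.single_eq_same, hm, topExp_apply]
      refine ofBits_add_two_pow hj (fun s h1 h2 => ?_) ?_ ?_ ?_ ?_
      · simp [h1, h2, Equiv.swap_apply_of_ne_of_ne h1 h2]
      · simp
      · simp [hne]
      · simp
      · simp [hf]
    · rw [Finsupp.single_eq_of_ne (Ne.symm hi), add_zero]
      by_cases hi' : f j = i
      · subst hi'
        rw [hm, topExp_apply]
        congr 1
        funext s
        split_ifs with h3 h4
        · simp [h3, hf.symm]
        · simp [h4]
        · rw [Function.comp_apply, Equiv.swap_apply_of_ne_of_ne h3 h4]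
      · exact hsame' i hi' hi
  have hdeg : m.degree + 2 ^ (j : ℕ) = d₁ n k := by
    rw [← degree_topExp f, ← hma, map_add, Finsupp.degree_single]
  have hone : ∀ c, (m c).testBit j = true → MvPolynomial.coeff (m + Finsupp.single c (2 ^ (j : ℕ)))
      (redPower n (2 ^ (j : ℕ)) (MvPolynomial.monomial m 1)) = 1 := by
    intro c hc
    rw [coeff_redPower_monomial, if_pos ⟨le_self_add, by rw [map_add, Finsupp.degree_single]⟩]
    refine Finset.prod_eq_one fun i _ => ?_
    rw [Finsupp.add_apply, Nat.add_sub_cancel_left]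
    by_cases hi : i = c
    · subst hi
      rw [Finsupp.single_eq_same, ZMod.natCast_eq_one_iff_odd]
      exact odd_choose_two_pow hc
    · rw [Finsupp.single_eq_of_ne hi, Nat.choose_zero_right, Nat.cast_one]
  have hff : topExp f ≠ topExp (f ∘ Equiv.swap j j') := by
    intro h
    have := congrFun (topExp_injective h) j
    rw [Function.comp_apply, Equiv.swap_apply_left] at this
    exact hf this
  set P := redPower n (2 ^ (j : ℕ)) (MvPolynomial.monomial m 1) with hP
  set S := MvPolynomial.monomial (topExp f) (1 : ZMod 2) +
    MvPolynomial.monomial (topExp (f ∘ Equiv.swap j j')) 1 with hS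
  have hPG : P ∈ G n k :=
    Submodule.mem_sup_left (Submodule.mem_iSup_of_mem _
      (Submodule.mem_iSup_of_mem Nat.one_le_two_pow ⟨_, rfl⟩))
  suffices h : P + S ∈ G n k from (Submodule.add_mem_iff_right _ hPG).1 h
  refine mem_G_of_coeff fun g hg => ?_
  by_contra hlow
  by_cases h1 : g = topExp f
  · rw [h1, hS, MvPolynomial.coeff_add, MvPolynomial.coeff_add, MvPolynomial.coeff_monomial,
      MvPolynomial.coeff_monomial, if_pos rfl, if_neg hff.symm, ← hma, hone _ (by simp [hbit])] at hg
    exact hg (by decide)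
  by_cases h2 : g = topExp (f ∘ Equiv.swap j j')
  · rw [h2, hS, MvPolynomial.coeff_add, MvPolynomial.coeff_add, MvPolynomial.coeff_monomial,
      MvPolynomial.coeff_monomial, if_pos rfl, if_neg hff, ← hmb, hone _ (by simp [hbit])] at hg
    exact hg (by decide)
  rw [hS, MvPolynomial.coeff_add, MvPolynomial.coeff_add, MvPolynomial.coeff_monomial,
    MvPolynomial.coeff_monomial, if_neg (Ne.symm h1), if_neg (Ne.symm h2), add_zero, add_zero,
    coeff_redPower_monomial] at hg
  split_ifs at hg with hc
  · obtain ⟨hle, hgd⟩ := hc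
    have hodd : ∀ i, Odd ((m i).choose (g i - m i)) := fun i => by
      have := Finset.prod_ne_zero_iff.1 hg i (Finset.mem_univ i)
      rwa [ZMod.natCast_ne_zero_iff_odd] at this
    obtain ⟨f', hf'⟩ := exists_eq_topExp hn (hgd.trans hdeg) hlow
    have hgi : ∀ i, g i = m i + (g i - m i) := fun i => by have := hle i; omega
    -- The increments have no digits below `j`. If digit `s` is incremented at `i`, then by Lucas
    -- `m` has that digit and `g` loses it. The zero of `m` at `f s` cannot be filled, again by
    -- Lucas, so column `s` of `g` would have two zeros.
    have hdvd : ∀ s ≤ (j : ℕ), ∀ i, 2 ^ s ∣ g i - m i := by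
      intro s
      induction s with
      | zero => simp
      | succ s ih =>
        intro hs i
        have ih := ih (by omega)
        have hsk : s < k := by omega
        have hsj : (⟨s, hsk⟩ : Fin k) ≠ j := fun h => by rw [← h] at hs; simp at hs
        have hsj' : (⟨s, hsk⟩ : Fin k) ≠ j' := fun h => by rw [← h] at hj; simp at hj; omega
        have hms : ∀ r, (m r).testBit s = decide (f ⟨s, hsk⟩ ≠ r) := fun r => by
          have := hbit r ⟨s, hsk⟩
          rwa [if_neg hsj, if_neg hsj'] at this
        have hgs : ∀ r, ((m r).testBit s ^^ (g r - m r).testBit s) =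
            decide (f' ⟨s, hsk⟩ ≠ r) := fun r => by
          have := testBit_topExp f' r ⟨s, hsk⟩
          rwa [← hf', hgi r, testBit_add_of_dvd _ _ (ih r)] at this
        by_contra hnd
        have hti : (g i - m i).testBit s = true := by
          obtain ⟨q, hq⟩ := ih i
          rw [hq, Nat.testBit_eq_decide_div_mod_eq, Nat.mul_div_cancel_left _ (by positivity),
            decide_eq_true_eq]
          by_contra hq'
          refine hnd ?_
          rw [hq, pow_succ]
          exact Nat.mul_dvd_mul_left _ (by omega)
        have hmi := testBit_of_odd_choose (hodd i) s hti
        have e1 : f' ⟨s, hsk⟩ = i := by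
          have := hgs i
          rw [hti, hmi] at this
          simpa using this
        have e2 : (m (f ⟨s, hsk⟩)).testBit s = false := by rw [hms]; simp
        have e3 : (g (f ⟨s, hsk⟩) - m (f ⟨s, hsk⟩)).testBit s = false := by
          by_contra h
          rw [Bool.not_eq_false] at h
          have := testBit_of_odd_choose (hodd _) s h
          rw [e2] at this
          exact Bool.false_ne_true this
        have e4 : f' ⟨s, hsk⟩ = f ⟨s, hsk⟩ := by
          have := hgs (f ⟨s, hsk⟩)
          rw [e2, e3] at this
          simpa using this
        rw [← e4, e1, hmi] at e2
        exact Bool.false_ne_true e2.symm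
    have hsum : ∑ i, (g i - m i) = 2 ^ (j : ℕ) := by
      have h3 : g.degree = m.degree + ∑ i, (g i - m i) := by
        rw [Finsupp.degree_eq_sum, Finsupp.degree_eq_sum, ← Finset.sum_add_distrib]
        exact Finset.sum_congr rfl fun i _ => hgi i
      omega
    obtain ⟨c, hc⟩ := exists_eq_single_of_dvd (by positivity) hsum (hdvd j le_rfl)
    have hgc : g = m + Finsupp.single c (2 ^ (j : ℕ)) := by
      ext i
      rw [Finsupp.add_apply, hgi i, congrFun hc i, Finsupp.single_eq_pi_single]
    have hca : f j ≠ c := fun h => h1 (by rw [hgc, ← h, hma])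
    have hcb : f j' ≠ c := fun h => h2 (by rw [hgc, ← h, hmb])
    -- If `c` is neither `f j` nor `f j'`, column `j + 1` of `g` keeps both zeros of `m`, whereas
    -- `topExp f'` has only one per column.
    have hz : ∀ r, r ≠ c → (m r).testBit j' = false → f' j' = r := by
      intro r hr hb
      have := testBit_topExp f' r j'
      rw [← hf', hgc, Finsupp.add_apply, Finsupp.single_eq_of_ne hr, add_zero, hb] at this
      simpa using this
    refine hf ((hz _ hca ?_).symm.trans (hz _ hcb ?_)) <;> rw [hbit, if_neg hne] <;> simp
  · exact hg rfl

/-- Adjacent transpositions generate the symmetric group, and the intermediate monomials cancel in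
characteristic two. -/
theorem monomial_add_monomial_perm_mem_G (hn : 1 ≤ n) (ρ : Equiv.Perm (Fin k)) :
    ∀ f : Fin k → Fin n, f.Injective → MvPolynomial.monomial (topExp f) 1 +
      MvPolynomial.monomial (topExp (f ∘ ρ)) 1 ∈ G n k := by
  have hself : ∀ p : Y n, p + p ∈ G n k := fun p => by
    rw [CharTwo.add_self_eq_zero]
    exact zero_mem _
  rcases k with _ | k
  · intro f _
    rw [Subsingleton.elim (f ∘ ρ) f]
    exact hself _
  · have hρ : ρ ∈ Submonoid.closure
        (Set.range fun i : Fin k => Equiv.swap i.castSucc i.succ) := by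
      rw [Equiv.Perm.mclosure_swap_castSucc_succ]
      exact Submonoid.mem_top _
    induction hρ using Submonoid.closure_induction with
    | mem ρ h =>
      obtain ⟨i, rfl⟩ := h
      intro f hf
      exact monomial_add_monomial_swap_mem_G hn f (by simp) (hf.ne (by simp [Fin.ext_iff]))
    | one => exact fun f _ => hself _
    | mul ρ ρ' _ _ h h' =>
      intro f hf
      have h1 := add_mem (h f hf) (h' (f ∘ ρ) (hf.comp ρ.injective))
      rwa [add_assoc, ← add_assoc (MvPolynomial.monomial (topExp (f ∘ ρ)) (1 : ZMod 2)),
        CharTwo.add_self_eq_zero, zero_add] at h1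

/-! ### Coordinates of the top layer -/

/-- The image of a monotone injection. -/
abbrev Mono.image (σ : Mono n k) : Finset (Fin n) := Finset.univ.map σ.toEmbedding

theorem Mono.card_image (σ : Mono n k) : σ.image.card = k := by
  rw [Finset.card_map, Finset.card_univ, Fintype.card_fin]

theorem Mono.image_injective : Function.Injective (Mono.image : Mono n k → Finset (Fin n)) := by
  intro σ τ h
  exact Set.powersetCard.ofFinEmbEquiv.injective (Subtype.ext h)

theorem Mono.exists_image_eq (T : Finset (Fin n)) (hT : T.card = k) :
    ∃ σ : Mono n k, σ.image = T :=
  ⟨Set.powersetCard.ofFinEmbEquiv.symm ⟨T, hT⟩,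
    congrArg Subtype.val (Set.powersetCard.ofFinEmbEquiv.apply_symm_apply
      (⟨T, hT⟩ : Set.powersetCard (Fin n) k))⟩

theorem card_mono : Nat.card (Mono n k) = n.choose k := by
  rw [Nat.card_congr Set.powersetCard.ofFinEmbEquiv, Set.powersetCard.card, Nat.card_fin]

/-- The product `x_{σ(1)} ⋯ x_{σ(k)}`. -/
abbrev xProd (σ : Mono n k) : Lam n :=
  ExteriorAlgebra.ιMulti (ZMod 2) k (fun j => Pi.single (σ j) 1)

/-- The basis of `Λᵏ` that consists of the square-free products of the generators. -/
def lamBasis (n k : ℕ) : Module.Basis (Mono n k) (ZMod 2) (LamDeg n k) :=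
  ((Pi.basisFun (ZMod 2) (Fin n)).exteriorPower k).reindex Set.powersetCard.ofFinEmbEquiv.symm

theorem coe_lamBasis (σ : Mono n k) : (lamBasis n k σ : Lam n) = xProd σ := by
  rw [lamBasis, Module.Basis.reindex_apply, exteriorPower.basis_apply, Equiv.symm_symm,
    exteriorPower.ιMulti_family_apply_coe, ExteriorAlgebra.ιMulti_family, Equiv.symm_apply_apply]
  congr 1
  funext j
  simp

theorem lamProj_coe (l : LamDeg n k) : lamProj n k (l : Lam n) = l := by
  rw [lamProj, LinearMap.comp_apply]
  change (DirectSum.decompose (fun i : ℕ => LamDeg n i) (l : Lam n)) k = l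
  rw [DirectSum.decompose_coe, DirectSum.of_eq_same]

theorem lamProj_of_ne {a : ℕ} (h : a ≠ k) {l : Lam n} (hl : l ∈ LamDeg n a) :
    lamProj n k l = 0 := by
  rw [lamProj, LinearMap.comp_apply]
  change (DirectSum.decompose (fun i : ℕ => LamDeg n i) l) k = 0
  exact Subtype.ext (DirectSum.decompose_of_mem_ne _ hl h)

theorem lamProj_xProd (σ : Mono n k) : lamProj n k (xProd σ) = lamBasis n k σ := by
  rw [← coe_lamBasis, lamProj_coe]

theorem topFunctional_homogeneousComponent (T : Finset (Fin n)) (p : Y n) :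
    topFunctional k T (MvPolynomial.homogeneousComponent (d₁ n k) p) = topFunctional k T p := by
  rw [topFunctional_apply, topFunctional_apply]
  refine Finset.sum_congr rfl fun f _ => ?_
  rw [MvPolynomial.coeff_homogeneousComponent, if_pos (degree_topExp f)]

/-- The functional on `(Y/G)^{2d₁}` induced by `topFunctional`. -/
def quotFunctional (σ : Mono n k) : YQuot n k →ₗ[ZMod 2] ZMod 2 :=
  Submodule.liftQ _ (topFunctional k σ.image ∘ₗ (YDeg n (d₁ n k)).subtype) fun _ hp =>
    topFunctional_eq_zero_of_mem σ.card_image hp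

/-- The functionals on `Λᵏ ⊗ (Y/G)^{2d₁}` dual to the classes of the `σ(z_k)`. -/
def topCoords (n k : ℕ) : Top n k →ₗ[ZMod 2] (Mono n k → ZMod 2) :=
  LinearMap.pi fun σ => (TensorProduct.lid (ZMod 2) (ZMod 2)).toLinearMap ∘ₗ
    TensorProduct.map ((lamBasis n k).coord σ) (quotFunctional σ)

/-- The composite `π ∘ pr_k`. -/
abbrev toTop (n k : ℕ) : N n →ₗ[ZMod 2] Top n k := proj n k ∘ₗ pr n k

theorem topCoords_toTop_tmul (l : Lam n) (p : Y n) (σ : Mono n k) :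
    topCoords n k (toTop n k (l ⊗ₜ p)) σ =
      (lamBasis n k).coord σ (lamProj n k l) * topFunctional k σ.image p := by
  rw [← topFunctional_homogeneousComponent]
  rfl

theorem topCoords_toTop_xProd (σ : Mono n k) (p : Y n) :
    topCoords n k (toTop n k (xProd σ ⊗ₜ p)) = Pi.single σ (topFunctional k σ.image p) := by
  funext τ
  rw [topCoords_toTop_tmul, lamProj_xProd, Module.Basis.coord_apply, Module.Basis.repr_self]
  by_cases h : τ = σ
  · subst h
    rw [Finsupp.single_eq_same, one_mul, Pi.single_eq_same]
  · rw [Finsupp.single_eq_of_ne h, zero_mul, Pi.single_eq_of_ne h]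

theorem topCoords_z (σ : Mono n k) : topCoords n k (toTop n k (z σ)) = Pi.single σ 1 := by
  rw [z, mon, topCoords_toTop_xProd, zExp_eq_topExp, topFunctional_monomial_topExp]
  · exact σ.injective.comp Fin.rev_injective
  · intro s; simp

theorem linearIndependent_z : LinearIndependent (ZMod 2) fun σ : Mono n k => toTop n k (z σ) := by
  refine LinearIndependent.of_comp (topCoords n k) ?_
  have : (topCoords n k ∘ fun σ : Mono n k => toTop n k (z σ)) = fun σ => Pi.single σ 1 :=
    funext topCoords_z
  rw [this]
  exact Pi.linearIndependent_single_one _ _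

theorem finrank_V : Module.finrank (ZMod 2) (V n k) = n.choose k := by
  rw [← card_mono, V]
  have := Fintype.ofFinite (Mono n k)
  rw [Nat.card_eq_fintype_card]
  exact finrank_span_eq_card linearIndependent_z

theorem topCoords_mon_of_alpha_lt (σ : Mono n k) {e : Fin n →₀ ℕ}
    (h : ∃ i, alpha (code σ e) i < k) : topCoords n k (toTop n k (mon σ e)) = 0 := by
  rw [mon, topCoords_toTop_xProd, topFunctional_monomial_of_ne, Pi.single_zero]
  rintro f hf hfT rfl
  obtain ⟨i, hi⟩ := h
  have := (all_le_alpha_iff σ f).2 ⟨hf, hfT⟩ i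
  omega

/-! ### Existence of complementary blocks -/

theorem toTop_eq_of_add_mem_G (l : Lam n) {p q : Y n} (hp : p ∈ YDeg n (d₁ n k))
    (hq : q ∈ YDeg n (d₁ n k)) (h : p + q ∈ G n k) :
    toTop n k (l ⊗ₜ p) = toTop n k (l ⊗ₜ q) := by
  have h1 : ∀ r : Y n, toTop n k (l ⊗ₜ r) =
      lamProj n k l ⊗ₜ Submodule.Quotient.mk (yProj n (d₁ n k) r) := fun r => rfl
  rw [h1, h1]
  congr 1
  rw [Submodule.Quotient.eq]
  change ((yProj n (d₁ n k) p : YDeg n (d₁ n k)) : Y n) - (yProj n (d₁ n k) q : Y n) ∈ G n k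
  rw [CharTwo.sub_eq_add]
  have h2 : ∀ r ∈ YDeg n (d₁ n k), ((yProj n (d₁ n k) r : YDeg n (d₁ n k)) : Y n) = r := by
    intro r hr
    change MvPolynomial.homogeneousComponent (d₁ n k) r = r
    rw [MvPolynomial.homogeneousComponent_of_mem hr, if_pos rfl]
  rwa [h2 p hp, h2 q hq]

theorem monomial_mem_YDeg {e : Fin n →₀ ℕ} {d : ℕ} (h : e.degree = d) :
    MvPolynomial.monomial e 1 ∈ YDeg n d :=
  MvPolynomial.isHomogeneous_monomial _ h

/-- This trichotomy makes the `σ(z_k)` and the monomials with some `αᵢ < k` span the top layer. -/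
theorem toTop_mon_cases (hn : 1 ≤ n) (σ : Mono n k) {e : Fin n →₀ ℕ} (he : e.degree = d₁ n k) :
    toTop n k (mon σ e) = 0 ∨ toTop n k (mon σ e) = toTop n k (z σ) ∨
      ∃ i, alpha (code σ e) i < k := by
  by_cases hl : IsLow k e
  · left
    have h := toTop_eq_of_add_mem_G (k := k) (xProd σ) (monomial_mem_YDeg he) (zero_mem _)
      (by rw [add_zero]; exact Submodule.mem_sup_right (Submodule.subset_span ⟨e, hl, rfl⟩))
    rwa [TensorProduct.tmul_zero, map_zero] at h
  · right
    obtain ⟨f, rfl⟩ := exists_eq_topExp hn he hl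
    by_contra! h
    obtain ⟨hf, hfT⟩ := (all_le_alpha_iff σ f).1 h.2
    refine h.1 ?_
    have h1 : ∀ s, ∃ t, σ (Fin.rev t) = f s := fun s => by
      obtain ⟨t, -, ht⟩ := Finset.mem_map.1 (hfT s)
      exact ⟨t.rev, by rw [Fin.rev_rev]; exact ht⟩
    choose ρ hρ using h1
    have hinj : ρ.Injective := fun a b hab => hf (by rw [← hρ, ← hρ, hab])
    have h2 := monomial_add_monomial_perm_mem_G hn
      (Equiv.ofBijective ρ (Finite.injective_iff_bijective.1 hinj)) (σ ∘ Fin.rev)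
      (σ.injective.comp Fin.rev_injective)
    have h3 : (σ ∘ Fin.rev) ∘ Equiv.ofBijective ρ (Finite.injective_iff_bijective.1 hinj) = f :=
      funext hρ
    rw [h3] at h2
    rw [z, zExp_eq_topExp]
    exact (toTop_eq_of_add_mem_G _ (monomial_mem_YDeg (degree_topExp _))
      (monomial_mem_YDeg (degree_topExp _)) h2).symm

theorem span_toTop_mon : Submodule.span (ZMod 2) {v : Top n k | ∃ (σ : Mono n k) (e : Fin n →₀ ℕ),
    e.degree = d₁ n k ∧ v = toTop n k (mon σ e)} = ⊤ := by
  set S := Submodule.span (ZMod 2) {v : Top n k | ∃ (σ : Mono n k) (e : Fin n →₀ ℕ),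
    e.degree = d₁ n k ∧ v = toTop n k (mon σ e)} with hS
  rw [eq_top_iff]
  rintro v -
  induction v using TensorProduct.induction_on with
  | zero => exact zero_mem _
  | add u v hu hv => exact add_mem hu hv
  | tmul l q =>
    obtain ⟨p, rfl⟩ := Submodule.Quotient.mk_surjective _ q
    have key : ∀ σ : Mono n k, lamBasis n k σ ⊗ₜ[ZMod 2]
        (Submodule.Quotient.mk p : YQuot n k) ∈ S := by
      intro σ
      have h1 : lamBasis n k σ ⊗ₜ[ZMod 2] (Submodule.Quotient.mk p : YQuot n k) =
          toTop n k (xProd σ ⊗ₜ (p : Y n)) := by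
        rw [← lamProj_xProd]
        change _ = lamProj n k (xProd σ) ⊗ₜ[ZMod 2]
          (Submodule.Quotient.mk (yProj n (d₁ n k) p) : YQuot n k)
        congr 2
        refine Subtype.ext ?_
        change _ = MvPolynomial.homogeneousComponent (d₁ n k) (p : Y n)
        rw [MvPolynomial.homogeneousComponent_of_mem p.2, if_pos rfl]
      rw [h1, (p : Y n).as_sum, TensorProduct.tmul_sum, map_sum]
      refine Submodule.sum_mem _ fun g hg => ?_
      have hg' : g.degree = d₁ n k := by
        have := p.2 (MvPolynomial.mem_support_iff.1 hg)
        rwa [Finsupp.degree_eq_weight_one]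
      rw [show MvPolynomial.monomial g (MvPolynomial.coeff g (p : Y n)) =
        MvPolynomial.coeff g (p : Y n) • MvPolynomial.monomial g (1 : ZMod 2) by
          rw [MvPolynomial.smul_monomial, smul_eq_mul, mul_one],
        TensorProduct.tmul_smul, map_smul]
      exact Submodule.smul_mem _ _ (Submodule.subset_span ⟨σ, g, hg', rfl⟩)
    rw [← (lamBasis n k).sum_repr l, TensorProduct.sum_tmul]
    refine Submodule.sum_mem _ fun σ _ => ?_
    rw [← TensorProduct.smul_tmul']
    exact Submodule.smul_mem _ _ (key σ)

theorem exists_isComplementaryBlock (hn : 1 ≤ n) :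
    ∃ M₀, IsComplementaryBlock n k M₀ := by
  -- Basis extension is done on indices rather than on vectors, because different monomials may have
  -- the same class.
  set v : Mono n k ⊕ (Mono n k × (Fin n →₀ ℕ)) → Top n k :=
    Sum.elim (fun σ => toTop n k (z σ)) (fun m => toTop n k (mon m.1 m.2)) with hv
  set A : Set (Mono n k × (Fin n →₀ ℕ)) :=
    {m | m.2.degree = d₁ n k ∧ ∃ i, alpha (code m.1 m.2) i < k} with hA
  set R : Set (Mono n k ⊕ (Mono n k × (Fin n →₀ ℕ))) := Set.range Sum.inl with hR
  have hs : LinearIndepOn (ZMod 2) v R :=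
    (linearIndepOn_range_iff Sum.inl_injective v).2 linearIndependent_z
  have hst : R ⊆ R ∪ Sum.inr '' A := Set.subset_union_left
  set B := hs.extend hst with hB
  have hBs : R ⊆ B := hs.subset_extend hst
  have hBt : B ⊆ R ∪ Sum.inr '' A := hs.extend_subset hst
  have hmem : ∀ m, Sum.inr m ∈ B → m ∈ A := by
    intro m hm
    rcases hBt hm with ⟨_, h⟩ | ⟨m', h, h'⟩
    · exact absurd h (by simp)
    · rwa [← Sum.inr_injective h']
  have hfam : (Sum.elim
      (fun m : ↥(Sum.inr ⁻¹' B : Set (Mono n k × (Fin n →₀ ℕ))) =>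
        proj n k (pr n k (mon m.1.1 m.1.2)))
      (fun σ : Mono n k => proj n k (pr n k (z σ)))) =
      (fun b : B => v b) ∘ Sum.elim (fun m => ⟨Sum.inr m.1, m.2⟩)
        (fun σ => ⟨Sum.inl σ, hBs ⟨σ, rfl⟩⟩) := by
    funext x
    rcases x with m | σ <;> rfl
  refine ⟨Sum.inr ⁻¹' B, fun m hm => (hmem m hm).1, fun m hm => (hmem m hm).2, ?_, ?_⟩
  · rw [hfam]
    refine LinearIndependent.comp (hs.linearIndepOn_extend hst) _ ?_
    rintro (m | σ) (m' | σ') h <;> simp only [Sum.elim_inl, Sum.elim_inr, Subtype.mk.injEq,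
      reduceCtorEq, Sum.inr.injEq, Sum.inl.injEq] at h
    · rw [Subtype.ext h]
    · rw [h]
  · rw [eq_top_iff, ← span_toTop_mon, Submodule.span_le]
    have hspan : ∀ b, b ∈ R ∪ Sum.inr '' A →
        v b ∈ Submodule.span (ZMod 2) (v '' B) := fun b hb =>
      hs.image_subset_span_image_extend hst ⟨b, hb, rfl⟩
    have hrange : v '' B ⊆ Set.range (Sum.elim
      (fun m : ↥(Sum.inr ⁻¹' B : Set (Mono n k × (Fin n →₀ ℕ))) =>
        proj n k (pr n k (mon m.1.1 m.1.2)))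
      (fun σ : Mono n k => proj n k (pr n k (z σ)))) := by
      rintro _ ⟨σ | m, hb, rfl⟩
      · exact ⟨Sum.inr σ, rfl⟩
      · exact ⟨Sum.inl ⟨m, hb⟩, rfl⟩
    rintro _ ⟨σ, e, he, rfl⟩
    refine Submodule.span_mono hrange ?_
    rcases toTop_mon_cases hn σ he with h | h | h
    · rw [h]; exact zero_mem _
    · rw [h]; exact hspan (Sum.inl σ) (Or.inl ⟨σ, rfl⟩)
    · exact hspan (Sum.inr (σ, e)) (Or.inr ⟨(σ, e), ⟨he, h⟩, rfl⟩)

/-! ### The local top-layer projection in coordinates -/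

theorem IsComplementaryBlock.coords_apply {M₀ : Set (Mono n k × (Fin n →₀ ℕ))}
    (h : IsComplementaryBlock n k M₀) (v : V n k) :
    h.coords v = topCoords n k (v : Top n k) := by
  suffices h' : h.coords.toLinearMap = topCoords n k ∘ₗ (V n k).subtype from
    LinearMap.congr_fun h' v
  refine h.basis.ext fun σ => ?_
  have hb : ((h.basis σ : V n k) : Top n k) = toTop n k (z σ) :=
    congrArg Subtype.val (Module.Basis.span_apply _ σ)
  rw [LinearMap.comp_apply, Submodule.subtype_apply, hb, topCoords_z]
  change h.basis.equivFun (h.basis σ) = _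
  funext τ
  rw [Module.Basis.equivFun_self, Pi.single_apply]
  simp [eq_comm]

/-- Since `topCoords` vanishes on `U₀`, the projection along `U₀` does not change it. The right-hand
side does not involve `M₀`. -/
theorem IsComplementaryBlock.coords_theta {M₀ : Set (Mono n k × (Fin n →₀ ℕ))}
    (h : IsComplementaryBlock n k M₀) (u : NDeg n (deg n k)) :
    h.coords (h.theta u) = topCoords n k (toTop n k (u : N n)) := by
  have hU : ∀ w ∈ U₀ n k M₀, topCoords n k w = 0 := by
    intro w hw
    suffices h' : U₀ n k M₀ ≤ LinearMap.ker (topCoords n k) from h' hw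
    refine Submodule.span_le.2 ?_
    rintro _ ⟨m, rfl⟩
    exact topCoords_mon_of_alpha_lt _ (h.alpha_lt m m.2)
  have hp := Submodule.projection_add_projection_eq_self h.isCompl (toTop n k (u : N n))
  rw [h.coords_apply]
  conv_rhs => rw [← hp, map_add, hU (Submodule.projection _ _ _ _) (Submodule.coe_mem _), add_zero]
  rfl

/-! ### The Bockstein on monomials -/

theorem contr_ιMulti (f : Module.Dual (ZMod 2) (Fin n → ZMod 2)) (a : ℕ)
    (m : Fin (a + 1) → Fin n → ZMod 2) :
    contr f (ExteriorAlgebra.ιMulti (ZMod 2) (a + 1) m) =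
      ∑ j, f (m j) • ExteriorAlgebra.ιMulti (ZMod 2) a (m ∘ j.succAbove) := by
  have h1 : contr f (1 : Lam n) = 0 := CliffordAlgebra.contractLeft_one _ _
  induction a with
  | zero =>
    rw [ExteriorAlgebra.ιMulti_succ_apply, contr_ι_mul]
    simp [ExteriorAlgebra.ιMulti_zero_apply, h1]
  | succ a ih =>
    rw [ExteriorAlgebra.ιMulti_succ_apply, contr_ι_mul, ih, Finset.mul_sum]
    conv_rhs => rw [Fin.sum_univ_succ]
    congr 1
    refine Finset.sum_congr rfl fun j _ => ?_
    rw [ExteriorAlgebra.ιMulti_succ_apply (m ∘ _), mul_smul_comm]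
    congr 3
    funext i
    simp [Matrix.vecTail]

/-- The monotone injection obtained by omitting the `j`-th value. -/
abbrev Mono.face (τ : Mono n (k + 1)) (j : Fin (k + 1)) : Mono n k :=
  (Fin.succAboveOrderEmb j).trans τ

theorem Mono.image_face (τ : Mono n (k + 1)) (j : Fin (k + 1)) :
    (τ.face j).image = τ.image.erase (τ j) := by
  ext i
  simp only [Finset.mem_map, Finset.mem_univ, true_and, Finset.mem_erase]
  constructor
  · rintro ⟨s, rfl⟩
    exact ⟨fun h => Fin.succAbove_ne j s (τ.injective h), j.succAbove s, rfl⟩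
  · rintro ⟨h, s, rfl⟩
    obtain ⟨s', rfl⟩ := Fin.exists_succAbove_eq (x := s) (y := j) fun hs => h (by rw [hs]; rfl)
    exact ⟨s', rfl⟩

theorem Q0_xProd_tmul (τ : Mono n (k + 1)) (p : Y n) :
    Q0 n (xProd τ ⊗ₜ p) = ∑ j, xProd (τ.face j) ⊗ₜ (MvPolynomial.X (τ j) * p) := by
  rw [Q0_tmul]
  simp_rw [contr_ιMulti, TensorProduct.sum_tmul]
  rw [Finset.sum_comm]
  refine Finset.sum_congr rfl fun j _ => ?_
  rw [Finset.sum_eq_single (τ j)]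
  · rw [LinearMap.proj_apply, Pi.single_eq_same, one_smul]
    rfl
  · intro i _ hi
    rw [LinearMap.proj_apply, Pi.single_eq_of_ne hi, zero_smul, TensorProduct.zero_tmul]
  · simp

theorem topCoords_Q0_xProd (τ : Mono n (k + 1)) (e : Fin n →₀ ℕ) :
    topCoords n k (toTop n k (Q0 n (xProd τ ⊗ₜ MvPolynomial.monomial e 1))) =
      ∑ j, Pi.single (τ.face j) (topFunctional k (τ.image.erase (τ j))
        (MvPolynomial.monomial (Finsupp.single (τ j) 1 + e) 1)) := by
  rw [Q0_xProd_tmul, map_sum, map_sum]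
  refine Finset.sum_congr rfl fun j _ => ?_
  rw [topCoords_toTop_xProd, Mono.image_face, MvPolynomial.X, MvPolynomial.monomial_mul, mul_one]

/-! ### Parity -/

/-- Filling the zero of column `s` gives the same exponent on both sides: column `s` full, the other
columns those of `f`. -/
theorem topExp_add_single (f : Fin k → Fin n) (s : Fin k) (i : Fin n) :
    topExp f + Finsupp.single (f s) (2 ^ (s : ℕ)) =
      topExp (Function.update f s i) + Finsupp.single i (2 ^ (s : ℕ)) := by
  have key : ∀ g : Fin k → Fin n, ∀ r, (topExp g + Finsupp.single (g s) (2 ^ (s : ℕ)) : Fin n →₀ ℕ) r =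
      2 ^ (s : ℕ) + ∑ t ∈ Finset.univ.erase s, (decide (g t ≠ r)).toNat * 2 ^ (t : ℕ) := by
    intro g r
    rw [Finsupp.add_apply, topExp_apply, ofBits_eq_sum,
      ← Finset.add_sum_erase _ _ (Finset.mem_univ s)]
    by_cases h : g s = r
    · subst h; simp [add_comm]
    · rw [Finsupp.single_eq_of_ne (Ne.symm h)]; simp [h]
  ext r
  have h1 := key (Function.update f s i) r
  rw [Function.update_self] at h1
  rw [key, h1]
  congr 1
  refine Finset.sum_congr rfl fun t ht => ?_
  rw [Function.update_of_ne (Finset.ne_of_mem_erase ht)]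

theorem single_add_eq_topExp_iff (f : Fin (k + 1) → Fin n) (i : Fin n) (e : Fin n →₀ ℕ) :
    Finsupp.single i 1 + e = topExp f ↔
      Finsupp.single (f 0) 1 + e = topExp (Function.update f 0 i) := by
  have h := topExp_add_single f 0 i
  rw [Fin.val_zero, pow_zero] at h
  rw [← add_left_inj (Finsupp.single (f 0) 1), h, add_comm (Finsupp.single i 1) e,
    add_right_comm, add_left_inj, add_comm]

theorem injective_update {f : Fin k → Fin n} (hf : f.Injective) (s : Fin k) {i : Fin n}
    (hi : ∀ t, f t ≠ i) : (Function.update f s i).Injective := by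
  intro a b h
  by_cases ha : a = s <;> by_cases hb : b = s
  · rw [ha, hb]
  · rw [ha, Function.update_self, Function.update_of_ne hb] at h
    exact absurd h.symm (hi b)
  · rw [hb, Function.update_self, Function.update_of_ne ha] at h
    exact absurd h (hi a)
  · rw [Function.update_of_ne ha, Function.update_of_ne hb] at h
    exact hf h

theorem update_mem_erase {W : Finset (Fin n)} {f : Fin k → Fin n} (hf : f.Injective) (s : Fin k)
    {i : Fin n} (hi : i ∈ W) (hfW : ∀ t, f t ∈ W.erase i) (t : Fin k) :
    Function.update f s i t ∈ W.erase (f s) := by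
  by_cases ht : t = s
  · rw [ht, Function.update_self]
    exact Finset.mem_erase.2 ⟨(Finset.ne_of_mem_erase (hfW s)).symm, hi⟩
  · rw [Function.update_of_ne ht]
    exact Finset.mem_erase.2 ⟨hf.ne ht, Finset.mem_of_mem_erase (hfW t)⟩

/-- The contributions are pairs `(i, f)` with `f` injective into `W.erase i`. The map exchanging `i`
and `f 0` preserves the condition on `e` by `single_add_eq_topExp_iff`, and it has no fixed point as
`f 0 ≠ i`. Column `0` is the right one because multiplication by `yᵢ` adds `2 ^ 0`. -/
theorem sum_topFunctional_erase (hk : 1 ≤ k) (W : Finset (Fin n)) (e : Fin n →₀ ℕ) :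
    ∑ i ∈ W, topFunctional k (W.erase i)
      (MvPolynomial.monomial (Finsupp.single i 1 + e) 1) = 0 := by
  obtain ⟨k, rfl⟩ : ∃ k', k = k' + 1 := ⟨k - 1, by omega⟩
  simp_rw [topFunctional_apply, MvPolynomial.coeff_monomial]
  rw [Finset.sum_sigma']
  refine Finset.sum_involution (fun x _ => ⟨x.2 0, Function.update x.2 0 x.1⟩) ?_ ?_ ?_ ?_
  · rintro ⟨i, f⟩ -
    simp only [single_add_eq_topExp_iff f i e]
    exact CharTwo.add_self_eq_zero _
  · rintro ⟨i, f⟩ hx _ h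
    simp only [Finset.mem_sigma, Finset.mem_filter, Finset.mem_univ, true_and] at hx
    exact Finset.ne_of_mem_erase (hx.2.2 0) (congrArg Sigma.fst h)
  · rintro ⟨i, f⟩ hx
    simp only [Finset.mem_sigma, Finset.mem_filter, Finset.mem_univ, true_and] at hx ⊢
    exact ⟨Finset.mem_of_mem_erase (hx.2.2 0),
      injective_update hx.2.1 0 fun t => Finset.ne_of_mem_erase (hx.2.2 t),
      update_mem_erase hx.2.1 0 hx.1 hx.2.2⟩
  · rintro ⟨i, f⟩ _
    simp

/-- The sum of the coordinates. -/
def coordSum (n k : ℕ) : (Mono n k → ZMod 2) →ₗ[ZMod 2] ZMod 2 := ∑ σ, LinearMap.proj σ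

theorem coordSum_apply (w : Mono n k → ZMod 2) : coordSum n k w = ∑ σ, w σ := by
  rw [coordSum, LinearMap.sum_apply]
  rfl

theorem coordSum_single (σ : Mono n k) (c : ZMod 2) : coordSum n k (Pi.single σ c) = c := by
  rw [coordSum_apply, Finset.sum_pi_single']
  simp

theorem coordSum_topCoords_Q0_xProd (hk : 1 ≤ k) (τ : Mono n (k + 1)) (p : Y n) :
    coordSum n k (topCoords n k (toTop n k (Q0 n (xProd τ ⊗ₜ p)))) = 0 := by
  suffices h : coordSum n k ∘ₗ topCoords n k ∘ₗ toTop n k ∘ₗ Q0 n ∘ₗ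
      TensorProduct.mk (ZMod 2) (Lam n) (Y n) (xProd τ) = 0 from LinearMap.congr_fun h p
  refine (MvPolynomial.basisMonomials (Fin n) (ZMod 2)).ext fun e => ?_
  rw [MvPolynomial.coe_basisMonomials]
  change coordSum n k (topCoords n k (toTop n k
    (Q0 n (xProd τ ⊗ₜ MvPolynomial.monomial e 1)))) = 0
  rw [topCoords_Q0_xProd, map_sum, ← sum_topFunctional_erase hk τ.image e, Finset.sum_map]
  exact Finset.sum_congr rfl fun j _ => coordSum_single _ _

theorem coordSum_topCoords_Q0 (hk : 1 ≤ k) {d : ℕ} {u : N n} (hu : u ∈ NDeg n d) :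
    coordSum n k (topCoords n k (toTop n k (Q0 n u))) = 0 := by
  set F := coordSum n k ∘ₗ topCoords n k ∘ₗ toTop n k ∘ₗ Q0 n with hF
  suffices h : NDeg n d ≤ LinearMap.ker F from h hu
  refine iSup_le fun a => iSup_le fun b => iSup_le fun _ => ?_
  rintro _ ⟨t, rfl⟩
  rw [LinearMap.mem_ker]
  induction t using TensorProduct.induction_on with
  | zero => simp
  | add s t hs ht => rw [map_add, map_add, hs, ht, add_zero]
  | tmul l p =>
    rw [TensorProduct.map_tmul, Submodule.subtype_apply, Submodule.subtype_apply]
    by_cases ha : a = k + 1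
    · subst ha
      rw [← (lamBasis n (k + 1)).sum_repr l, Submodule.coe_sum, TensorProduct.sum_tmul, map_sum]
      refine Finset.sum_eq_zero fun τ _ => ?_
      rw [Submodule.coe_smul, ← TensorProduct.smul_tmul', map_smul, coe_lamBasis]
      have : F (xProd τ ⊗ₜ (p : Y n)) = 0 := coordSum_topCoords_Q0_xProd hk τ p
      rw [this, smul_zero]
    -- `Q0` lowers the exterior degree by one, so only exterior degree `k + 1` reaches the `k`-th
    -- summand.
    · have h0 : toTop n k (Q0 n ((l : Lam n) ⊗ₜ (p : Y n))) = 0 := by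
        rw [Q0_tmul, map_sum]
        refine Finset.sum_eq_zero fun i _ => ?_
        have h1 : lamProj n k (contr (LinearMap.proj i) (l : Lam n)) = 0 := by
          rcases a with _ | a
          · obtain ⟨l, hl⟩ := l
            rw [LamDeg, ExteriorAlgebra.exteriorPower, pow_zero] at hl
            obtain ⟨r, rfl⟩ := Submodule.mem_one.1 hl
            have : contr (LinearMap.proj i) (algebraMap (ZMod 2) (Lam n) r) = 0 :=
              CliffordAlgebra.contractLeft_algebraMap _ _ r
            rw [this, map_zero]
          · exact lamProj_of_ne (by omega) (contr_mem _ a l.2)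
        change proj n k (lamProj n k (contr (LinearMap.proj i) (l : Lam n)) ⊗ₜ yProj n _ _) = 0
        rw [h1, TensorProduct.zero_tmul, map_zero]
      change coordSum n k (topCoords n k (toTop n k (Q0 n ((l : Lam n) ⊗ₜ (p : Y n))))) = 0
      rw [h0, map_zero, map_zero]

/-! ### Even vectors in the image -/

theorem exists_injective_mem (T : Finset (Fin n)) (hT : T.card = k + 1) {i : Fin n} (hi : i ∈ T) :
    ∃ f : Fin (k + 1) → Fin n, f.Injective ∧ (∀ s, f s ∈ T) ∧ f 0 = i := by
  obtain ⟨σ, hσ⟩ := Mono.exists_image_eq T hT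
  have hmem : ∀ s, σ s ∈ T := fun s => by rw [← hσ]; exact Finset.mem_map_of_mem _ (Finset.mem_univ s)
  obtain ⟨s, hs⟩ := exists_eq_of_injective hT σ.injective hmem hi
  refine ⟨σ ∘ Equiv.swap 0 s, σ.injective.comp (Equiv.injective _), fun t => hmem _, ?_⟩
  rw [Function.comp_apply, Equiv.swap_apply_left, hs]

/-- An exponent detected exactly by the faces of `W` that omit `i` or `i'`. -/
theorem exists_exponent (hk : 1 ≤ k) {W : Finset (Fin n)} (hW : W.card = k + 1) {i i' : Fin n}
    (hi : i ∈ W) (hi' : i' ∈ W) (hne : i ≠ i') : ∃ e : Fin n →₀ ℕ, e.degree + 1 = d₁ n k ∧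
      ∀ r ∈ W, topFunctional k (W.erase r) (MvPolynomial.monomial (Finsupp.single r 1 + e) 1) =
        if r = i ∨ r = i' then 1 else 0 := by
  obtain ⟨k, rfl⟩ : ∃ k', k = k' + 1 := ⟨k - 1, by omega⟩
  have hcard : (W.erase i).card = k + 1 := by rw [Finset.card_erase_of_mem hi, hW]; rfl
  obtain ⟨f, hf, hfW, hf0⟩ := exists_injective_mem (W.erase i) hcard
    (Finset.mem_erase.2 ⟨hne.symm, hi'⟩)
  -- As `f 0 = i' ≠ i`, the exponent at `i` is odd, so `yᵢ` can be divided out; the quotient is the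
  -- witness `y^e`.
  have hle : Finsupp.single i 1 ≤ topExp f := by
    rw [Finsupp.single_le_iff, Nat.one_le_iff_ne_zero]
    intro h
    have := testBit_topExp f i 0
    rw [h] at this
    simp [hf0, hne.symm] at this
  obtain ⟨e, he⟩ := exists_add_of_le hle
  refine ⟨e, ?_, fun r hr => ?_⟩
  · rw [← degree_topExp f, he, map_add, Finsupp.degree_single, add_comm]
  split_ifs with h
  · rcases h with rfl | rfl
    · rw [← he]
      exact topFunctional_monomial_topExp _ hf hfW
    · have h1 := (single_add_eq_topExp_iff f i e).1 he.symm
      rw [hf0] at h1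
      rw [h1]
      refine topFunctional_monomial_topExp _
        (injective_update hf 0 fun t => Finset.ne_of_mem_erase (hfW t)) ?_
      have := update_mem_erase hf 0 hi hfW
      rwa [hf0] at this
  · push Not at h
    -- Column `0` of `e` has zeros at both `i` and `i'`, and multiplying by `y_r` fills neither.
    refine topFunctional_monomial_of_ne _ _ fun f' _ _ hf' => hne ?_
    have h1 : ∀ t, t ≠ r → (e t).testBit 0 = false → f' 0 = t := by
      intro t ht hb
      have := testBit_topExp f' t 0
      rw [← hf', Finsupp.add_apply, Finsupp.single_eq_of_ne ht, zero_add, Fin.val_zero, hb] at this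
      simpa using this
    have h2 : ∀ t, topExp f t = Finsupp.single i 1 t + e t := fun t => by rw [he, Finsupp.add_apply]
    rw [← h1 i h.1.symm, ← h1 i' h.2.symm]
    · have := testBit_topExp f i' 0
      rw [h2, Finsupp.single_eq_of_ne hne.symm, zero_add, hf0] at this
      simpa using this
    · have := testBit_topExp f i 0
      rw [h2, Finsupp.single_eq_same, hf0, Fin.val_zero, Nat.testBit_zero] at this
      simp only [hne.symm, ne_eq, not_false_eq_true, decide_true, decide_eq_true_eq] at this
      rw [Nat.testBit_zero, decide_eq_false_iff_not]
      omega

theorem xProd_tmul_mem_NDeg (τ : Mono n (k + 1)) {e : Fin n →₀ ℕ} (he : e.degree + 1 = d₁ n k) :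
    xProd τ ⊗ₜ MvPolynomial.monomial e 1 ∈ NDeg n (deg n k - 1) := by
  refine Submodule.mem_iSup_of_mem (k + 1) (Submodule.mem_iSup_of_mem e.degree
    (Submodule.mem_iSup_of_mem (by unfold deg; omega) ?_))
  refine ⟨lamBasis n (k + 1) τ ⊗ₜ ⟨MvPolynomial.monomial e 1, monomial_mem_YDeg rfl⟩, ?_⟩
  rw [TensorProduct.map_tmul, Submodule.subtype_apply, Submodule.subtype_apply, coe_lamBasis]

/-- The coordinate vectors of the elements of `Q₀(N^{d-1,*})`. -/
def boundaryCoords (n k : ℕ) : Submodule (ZMod 2) (Mono n k → ZMod 2) :=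
  (NDeg n (deg n k - 1)).map (topCoords n k ∘ₗ toTop n k ∘ₗ Q0 n)

theorem single_face_add_single_face_mem (hk : 1 ≤ k) (τ : Mono n (k + 1)) {j j' : Fin (k + 1)}
    (hne : j ≠ j') :
    Pi.single (τ.face j) 1 + Pi.single (τ.face j') 1 ∈ boundaryCoords n k := by
  have hmem : ∀ j, τ j ∈ τ.image := fun j => Finset.mem_map_of_mem _ (Finset.mem_univ j)
  obtain ⟨e, he, hval⟩ := exists_exponent hk τ.card_image (hmem j) (hmem j')
    (τ.injective.ne hne)
  refine ⟨_, xProd_tmul_mem_NDeg τ he, ?_⟩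
  change topCoords n k (toTop n k (Q0 n (xProd τ ⊗ₜ MvPolynomial.monomial e 1))) = _
  rw [topCoords_Q0_xProd]
  simp_rw [hval _ (hmem _), τ.injective.eq_iff]
  rw [← Finset.sum_pair (f := fun r => (Pi.single (τ.face r) 1 : Mono n k → ZMod 2)) hne]
  symm
  refine Finset.sum_subset_zero_on_sdiff (Finset.subset_univ _) (fun r hr => ?_) fun r hr => ?_
  · simp only [Finset.mem_sdiff, Finset.mem_univ, true_and, Finset.mem_insert,
      Finset.mem_singleton] at hr
    rw [if_neg hr, Pi.single_zero]
  · simp only [Finset.mem_insert, Finset.mem_singleton] at hr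
    rw [if_pos hr]

/-- Induction on the distance between the images. With `a` in `σ` only and `b` in `σ'` only, the
faces of `insert b σ.image` omitting `b` and `a` are `σ` and a set one step closer to `σ'`. -/
theorem single_add_single_mem (hk : 1 ≤ k) (σ' : Mono n k) (c : ℕ) :
    ∀ σ : Mono n k, (σ.image \ σ'.image).card = c →
      Pi.single σ 1 + Pi.single σ' 1 ∈ boundaryCoords n k := by
  induction c with
  | zero =>
    intro σ h
    have h1 : σ.image ⊆ σ'.image := Finset.sdiff_eq_empty_iff_subset.1 (Finset.card_eq_zero.1 h)
    have h2 : σ = σ' := Mono.image_injective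
      (Finset.eq_of_subset_of_card_le h1 (by rw [σ.card_image, σ'.card_image]))
    rw [h2, ZModModule.add_self]
    exact zero_mem _
  | succ c ih =>
    intro σ h
    obtain ⟨a, ha⟩ := Finset.card_pos.1 (show 0 < (σ.image \ σ'.image).card by omega)
    have h' : (σ'.image \ σ.image).card = c + 1 := by
      rw [← h]
      exact (Finset.card_sdiff_comm (by rw [σ.card_image, σ'.card_image])).symm
    obtain ⟨b, hb⟩ := Finset.card_pos.1 (show 0 < (σ'.image \ σ.image).card by omega)
    rw [Finset.mem_sdiff] at ha hb
    have hWc : (insert b σ.image).card = k + 1 := by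
      rw [Finset.card_insert_of_notMem hb.2, σ.card_image]
    obtain ⟨τ, hτ⟩ := Mono.exists_image_eq _ hWc
    have hsurj : ∀ r ∈ insert b σ.image, ∃ j, τ j = r := fun r hr => by
      rw [← hτ] at hr
      obtain ⟨j, -, hj⟩ := Finset.mem_map.1 hr
      exact ⟨j, hj⟩
    obtain ⟨j, hj⟩ := hsurj b (Finset.mem_insert_self _ _)
    obtain ⟨j', hj'⟩ := hsurj a (Finset.mem_insert_of_mem ha.1)
    have hne : j ≠ j' := fun h => hb.2 (by rw [← hj, h, hj']; exact ha.1)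
    have h1 : τ.face j = σ := Mono.image_injective (by
      rw [Mono.image_face, hτ, hj, Finset.erase_insert hb.2])
    have h2 : (τ.face j').image = (insert b σ.image).erase a := by
      rw [Mono.image_face, hτ, hj']
    have h3 : ((τ.face j').image \ σ'.image).card = c := by
      have : (τ.face j').image \ σ'.image = (σ.image \ σ'.image).erase a := by
        rw [h2]
        ext r
        simp only [Finset.mem_sdiff, Finset.mem_erase, Finset.mem_insert]
        constructor
        · rintro ⟨⟨h1, h2 | h2⟩, h3⟩
          · exact absurd (h2 ▸ hb.1) h3
          · exact ⟨h1, h2, h3⟩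
        · rintro ⟨h1, h2, h3⟩
          exact ⟨⟨h1, Or.inr h2⟩, h3⟩
      rw [this, Finset.card_erase_of_mem (Finset.mem_sdiff.2 ha), h]
      rfl
    have h4 := add_mem (single_face_add_single_face_mem hk τ hne) (ih _ h3)
    rwa [h1, add_assoc, ← add_assoc (Pi.single (τ.face j') 1), ZModModule.add_self,
      zero_add] at h4

theorem boundaryCoords_eq (hk : 1 ≤ k) (hkn : k < n) :
    boundaryCoords n k = LinearMap.ker (coordSum n k) := by
  refine le_antisymm ?_ fun w hw => ?_
  · rintro _ ⟨u, hu, rfl⟩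
    exact coordSum_topCoords_Q0 hk hu
  · obtain ⟨σ₀⟩ : Nonempty (Mono n k) := ⟨Fin.castLEOrderEmb hkn.le⟩
    rw [LinearMap.mem_ker, coordSum_apply] at hw
    -- The total coefficient of `Pi.single σ₀ 1` is the coordinate sum of `w`, which is zero.
    have h : w = ∑ σ, w σ • (Pi.single σ 1 + Pi.single σ₀ 1 : Mono n k → ZMod 2) := by
      simp_rw [smul_add]
      rw [Finset.sum_add_distrib, ← Finset.sum_smul, hw, zero_smul, add_zero]
      exact pi_eq_sum_univ' w
    rw [h]
    exact Submodule.sum_mem _ fun σ _ =>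
      Submodule.smul_mem _ _ (single_add_single_mem hk σ₀ _ σ rfl)

theorem IsComplementaryBlock.map_coords {M₀ : Set (Mono n k × (Fin n →₀ ℕ))}
    (h : IsComplementaryBlock n k M₀) (hk : 1 ≤ k) :
    ((Q0Image n k).map h.theta).map h.coords.toLinearMap = boundaryCoords n k := by
  ext w
  constructor
  · rintro ⟨_, ⟨v, ⟨u, hu, huv⟩, rfl⟩, rfl⟩
    refine ⟨u, hu, ?_⟩
    rw [LinearEquiv.coe_coe, h.coords_theta]
    exact congrArg (fun t => topCoords n k (toTop n k t)) huv
  · rintro ⟨u, hu, rfl⟩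
    refine ⟨_, ⟨⟨Q0 n u, Q0_image_le hk ⟨u, hu, rfl⟩⟩, ⟨u, hu, rfl⟩, rfl⟩, ?_⟩
    rw [LinearEquiv.coe_coe, h.coords_theta]
    rfl

end MotivicHit

end

/-! ### The parity theorem. -/

theorem mainTheorem2 (n k : ℕ) (hk : 1 ≤ k) (hkn : k < n) :
    (∃ M₀, MotivicHit.IsComplementaryBlock n k M₀) ∧
    Module.finrank (ZMod 2) (MotivicHit.V n k) = n.choose k ∧
    ∀ (M₀ : Set (MotivicHit.Mono n k × (Fin n →₀ ℕ)))
      (h : MotivicHit.IsComplementaryBlock n k M₀),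
      (MotivicHit.Q0Image n k).map h.theta = LinearMap.ker h.parity ∧
      (fun v => h.coords v) '' ((MotivicHit.Q0Image n k).map h.theta : Set (MotivicHit.V n k)) =
        {w : MotivicHit.Mono n k → ZMod 2 | ∑ σ, w σ = 0} := by
  refine ⟨MotivicHit.exists_isComplementaryBlock (by omega), MotivicHit.finrank_V,
    fun M₀ h => ?_⟩
  have h1 := (h.map_coords hk).trans (MotivicHit.boundaryCoords_eq hk hkn)
  have hpar : ∀ v, h.parity v = MotivicHit.coordSum n k (h.coords v) := fun v => by
    rw [MotivicHit.coordSum_apply, MotivicHit.IsComplementaryBlock.parity, LinearMap.sum_apply]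
    rfl
  constructor
  · ext v
    rw [LinearMap.mem_ker, hpar, ← LinearMap.mem_ker, ← h1]
    exact ((Submodule.mem_map_equiv (e := h.coords) _).trans
      (by rw [LinearEquiv.symm_apply_apply])).symm
  · have h2 := congrArg (fun S : Submodule (ZMod 2) (MotivicHit.Mono n k → ZMod 2) =>
      (S : Set (MotivicHit.Mono n k → ZMod 2))) h1
    refine h2.trans ?_
    ext w
    rw [SetLike.mem_coe, LinearMap.mem_ker, MotivicHit.coordSum_apply]
    rfl
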